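/- Let $(\Omega,\mathcal F,\mathbb P)$ be an atomless probability space, let $\mathcal L^\infty$ be the set of bounded random variables on it and $\mathcal L_1$ the set of random variables with values in $[0,1]$. Let $h:[0,1]\to\mathbb R$ be a distortion function, that is, $h$ is nondecreasing with $h(0)=0$ and $h(1)=1$, and let $\rho:\mathcal L^\infty\to\mathbb R$ be the distortion risk measure with distortion function $h$, that is, $$\rho(X)=\int_0^\infty h(\mathbb P(X>x))\,\mathrm dx+\int_{-\infty}^0\bigl(h(\mathbb P(X>x))-1\bigr)\,\mathrm dx,\qquad X\in\mathcal L^\infty .$$ A sequence $(L_\ell)_{\ell\ge1}$ of random variables is called conditionally iid if there is a random vector $Z$ such that, given $Z$, the variables $L_1,L_2,\dots$ are independent and identically distributed. For such a sequence and an integer $\ell\ge1$ write $L^{(\ell)}=(L_1+\dots+L_\ell)/\ell$. Then the following four conditions are equivalent: (i) $h$ is concave on $[0,1)$; (ii) [PE]: for every conditionally iid sequence $(L_\ell)_{\ell\ge1}$ in $\mathcal L_1$, all integers $1\le\ell\le\ell'$ and all $K\in[0,1)$, $$\rho\left(\frac{(L^{(\ell)}-K)_+}{1-K}\right)\ \ge\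 \rho\left(\frac{(L^{(\ell')}-K)_+}{1-K}\right);$$ (iii) [PE*]: for every conditionally iid sequence $(L_\ell)_{\ell\ge1}$ in $\mathcal L_1$ and all integers $1\le\ell\le\ell'$, $\rho(L^{(\ell)})\ge\rho(L^{(\ell')})$; (iv) for every conditionally iid sequence $(L_\ell)_{\ell\ge1}$ in $\mathcal L_1$ and every integer $\ell\ge1$, $\rho(L_1)\ge\rho(L^{(\ell)})$. -/

import Mathlib

open MeasureTheory ProbabilityTheory

noncomputable section

/-- A measure is atomless if every measurable set of positive measure contains a measurable subset
of strictly smaller positive measure. (This is stronger than all singletons being null.) -/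
def IsAtomless {Ω : Type*} [MeasurableSpace Ω] (P : Measure Ω) : Prop :=
  ∀ A : Set Ω, MeasurableSet A → 0 < P A →
    ∃ B : Set Ω, B ⊆ A ∧ MeasurableSet B ∧ 0 < P B ∧ P B < P A

/-- The set of all bounded random variables. -/
def boundedRV (Ω : Type*) [MeasurableSpace Ω] : Set (Ω → ℝ) :=
  {X | Measurable X ∧ ∃ C : ℝ, ∀ ω, |X ω| ≤ C}

/-- The set of all random variables with values in `[0,1]`. -/
def unitRV (Ω : Type*) [MeasurableSpace Ω] : Set (Ω → ℝ) :=
  {X | Measurable X ∧ ∀ ω, X ω ∈ Set.Icc (0 : ℝ) 1}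

/-- The Choquet integral of `X` with respect to a set function `ν`. For a capacity `ν` and a bounded
random variable `X`, both integrands are monotone, bounded, and vanish outside a bounded interval,
so both integrals are finite. -/
def choquetIntegral {Ω : Type*} (ν : Set Ω → ℝ) (X : Ω → ℝ) : ℝ :=
  (∫ x in Set.Ioi (0 : ℝ), ν {ω | x < X ω}) + ∫ x in Set.Iio (0 : ℝ), (ν {ω | x < X ω} - 1)

/-- A distortion function on `[0,1]` (the values of `h` outside `[0,1]` are irrelevant):
nondecreasing with `h 0 = 0` and `h 1 = 1`. No continuity is required. -/
structure IsDistortionFunction (h : ℝ → ℝ) : Prop where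
  monotoneOn : MonotoneOn h (Set.Icc 0 1)
  map_zero : h 0 = 0
  map_one : h 1 = 1

/-- `ρ` is the distortion risk measure with distortion function `h`: on bounded random variables it
is the Choquet integral with respect to the capacity `h ∘ P`. The values of `ρ` at functions that
are not bounded random variables are irrelevant. -/
structure IsDistortionRiskMeasure {Ω : Type*} [MeasurableSpace Ω] (P : Measure Ω) (h : ℝ → ℝ)
    (ρ : (Ω → ℝ) → ℝ) : Prop where
  distortion : IsDistortionFunction h
  eq_choquet : ∀ X ∈ boundedRV Ω, ρ X = choquetIntegral (fun A => h (P.real A)) X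

/-- The sequence `L` is conditionally iid given the sub-σ-algebra `m`: its members are conditionally
independent and have the same conditional distribution given `m`. -/
structure IsCondIIDGiven {Ω : Type*} (m : MeasurableSpace Ω) [mΩ : MeasurableSpace Ω]
    (P : Measure Ω) (L : ℕ → Ω → ℝ) : Prop where
  indep : ∀ (s : Finset ℕ) (B : ℕ → Set ℝ), (∀ i ∈ s, MeasurableSet (B i)) →
    P⟦⋂ i ∈ s, L i ⁻¹' B i | m⟧ =ᵐ[P] ∏ i ∈ s, P⟦L i ⁻¹' B i | m⟧
  ident : ∀ (i j : ℕ) (B : Set ℝ), MeasurableSet B →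
    P⟦L i ⁻¹' B | m⟧ =ᵐ[P] P⟦L j ⁻¹' B | m⟧

/-- The sequence `L` of random variables is conditionally iid: there is a random vector `Z` such
that `L` is conditionally iid given (the σ-algebra generated by) `Z`. -/
def IsCondIID {Ω : Type*} [MeasurableSpace Ω] (P : Measure Ω) (L : ℕ → Ω → ℝ) : Prop :=
  ∃ (d : ℕ) (Z : Ω → Fin d → ℝ), Measurable Z ∧
    IsCondIIDGiven (MeasurableSpace.comap Z inferInstance) P L

/-- The pool loss `(L₁ + ⋯ + L_ℓ) / ℓ` for `ℓ ≥ 1`. Sequences are indexed from `0`, so that the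
first asset `L₁` is `L 0`. -/
def poolLoss {Ω : Type*} (L : ℕ → Ω → ℝ) (ℓ : ℕ) : Ω → ℝ :=
  fun ω => (∑ i ∈ Finset.range ℓ, L i ω) / (ℓ : ℝ)

/-- The normalized loss `(X - K)₊ / (1 - K)` of the senior tranche with attachment point `K`. -/
def seniorTranche {Ω : Type*} (K : ℝ) (X : Ω → ℝ) : Ω → ℝ :=
  fun ω => max (X ω - K) 0 / (1 - K)

/-- Pooling effect consistency [PE]. -/
def PoolingEffectConsistent {Ω : Type*} [MeasurableSpace Ω] (P : Measure Ω)
    (ρ : (Ω → ℝ) → ℝ) : Prop :=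
  ∀ L : ℕ → Ω → ℝ, (∀ i, L i ∈ unitRV Ω) → IsCondIID P L →
    ∀ ℓ ℓ' : ℕ, 1 ≤ ℓ → ℓ ≤ ℓ' → ∀ K ∈ Set.Ico (0 : ℝ) 1,
      ρ (seniorTranche K (poolLoss L ℓ)) ≥ ρ (seniorTranche K (poolLoss L ℓ'))

/-- The weaker property [PE*]: the inequality of [PE] for `K = 0` only. -/
def WeakPoolingEffectConsistent {Ω : Type*} [MeasurableSpace Ω] (P : Measure Ω)
    (ρ : (Ω → ℝ) → ℝ) : Prop :=
  ∀ L : ℕ → Ω → ℝ, (∀ i, L i ∈ unitRV Ω) → IsCondIID P L →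
    ∀ ℓ ℓ' : ℕ, 1 ≤ ℓ → ℓ ≤ ℓ' → ρ (poolLoss L ℓ) ≥ ρ (poolLoss L ℓ')

end

/-! ### Intermediate values of an atomless measure -/

section Atomless

variable {Ω : Type*} [MeasurableSpace Ω] {P : Measure Ω}

/-! Concavity gives [PE] by a convex-order argument. The average of `ℓ + 1` losses is the mean of
its `ℓ + 1` leave-one-out averages, and by exchangeability each of these has the law of `poolLoss L
ℓ`; so Jensen shows that pooling decreases the expectation of every continuous convex function
(`integral_comp_poolLoss_le`). Applied to `x ↦ max ((x - K)₊ / (1 - K)) t`, this orders the tail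
integrals over `(t, 1]` of the survival functions `F` (small pool) and `G` (large pool). A
supergradient `φ` of `h` gives `h (F x) - h (G x) ≥ φ (F x) * (F x - G x)`, with a weight `φ (F x)`
that is nondecreasing in `x`; hence the integral of the right side is nonnegative.

Two defects of `h` need care. It may be arbitrarily steep, or jump, at `0`; truncation by `n * p`
and dominated convergence deal with this. It may jump at `1`, where concavity says nothing; but `F`
and `G` equal `1` at the same points, because pooling preserves the essential infimum
(`ae_lt_poolLoss_iff`).

For the converse, let all losses be `1` on an event of probability `p` and iid Bernoulli(`θ`) on a
disjoint event of probability `r`. Then `L 0` is Bernoulli with parameter `p + r * θ`, so its risk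
is `h (p + r * θ)`, while by the law of large numbers a large pool loses about `θ` on the second
event. Comparing risks yields the concavity inequality in the limit (`le_comp_of_pool_le`).
Sierpiński's theorem provides such sequences on any atomless space.

[PE] gives [PE*] by taking `K = 0`, and [PE*] gives the last condition by taking `ℓ = 1`. -/

theorem IsAtomless.exists_subset_le_half [IsFiniteMeasure P] (hP : IsAtomless P) {A : Set Ω}
    (hA : MeasurableSet A) (h0 : 0 < P.real A) :
    ∃ B ⊆ A, MeasurableSet B ∧ 0 < P.real B ∧ P.real B ≤ P.real A / 2 := by
  obtain ⟨B, hBA, hB, hB0, hBlt⟩ := hP A hA (by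
    rw [Measure.real] at h0; exact (ENNReal.toReal_pos_iff.1 h0).1)
  have h1 : 0 < P.real B := ENNReal.toReal_pos hB0.ne' (measure_ne_top _ _)
  have h2 : P.real B < P.real A := (ENNReal.toReal_lt_toReal (by simp) (by simp)).2 hBlt
  have h3 : P.real (A \ B) = P.real A - P.real B := measureReal_sdiff hBA hB
  rcases le_total (P.real B) (P.real A / 2) with h | h
  · exact ⟨B, hBA, hB, h1, h⟩
  · exact ⟨A \ B, Set.sdiff_subset, hA.diff hB, by linarith, by linarith⟩

theorem IsAtomless.exists_subset_le [IsFiniteMeasure P] (hP : IsAtomless P) {A : Set Ω}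
    (hA : MeasurableSet A) (h0 : 0 < P.real A) {ε : ℝ} (hε : 0 < ε) :
    ∃ B ⊆ A, MeasurableSet B ∧ 0 < P.real B ∧ P.real B ≤ ε := by
  have key : ∀ n : ℕ, ∃ B ⊆ A, MeasurableSet B ∧ 0 < P.real B ∧
      P.real B ≤ P.real A * (1 / 2) ^ n := by
    intro n
    induction n with
    | zero => exact ⟨A, subset_rfl, hA, h0, by simp⟩
    | succ n ih =>
      obtain ⟨B, hBA, hB, hB0, hB1⟩ := ih
      obtain ⟨C, hCB, hC, hC0, hC1⟩ := hP.exists_subset_le_half hB hB0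
      refine ⟨C, hCB.trans hBA, hC, hC0, hC1.trans ?_⟩
      rw [pow_succ]; linarith
  obtain ⟨n, hn⟩ := exists_pow_lt_of_lt_one (div_pos hε h0) (by norm_num : (1 / 2 : ℝ) < 1)
  obtain ⟨B, hBA, hB, hB0, hB1⟩ := key n
  refine ⟨B, hBA, hB, hB0, hB1.trans ?_⟩
  rw [lt_div_iff₀ h0] at hn
  linarith

/-- **Sierpiński's theorem**: an atomless finite measure takes every intermediate value. -/
theorem IsAtomless.exists_subset_eq [IsFiniteMeasure P] (hP : IsAtomless P) {A : Set Ω}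
    (hA : MeasurableSet A) {c : ℝ} (hc0 : 0 ≤ c) (hcA : c ≤ P.real A) :
    ∃ B ⊆ A, MeasurableSet B ∧ P.real B = c := by
  let T := {B : Set Ω // MeasurableSet B ∧ B ⊆ A ∧ P.real B ≤ c}
  -- Greedy choice: a piece of the remainder that still fits under `c` and has at least half the
  -- largest possible measure.
  have step : ∀ B : T, ∃ E : Set Ω, MeasurableSet E ∧ E ⊆ A \ B.1 ∧ P.real E ≤ c - P.real B.1 ∧
      ∀ E', MeasurableSet E' → E' ⊆ A \ B.1 → P.real E' ≤ c - P.real B.1 →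
        P.real E' ≤ 2 * P.real E := by
    rintro ⟨B, hB, hBA, hBc⟩
    dsimp only
    set S : Set ℝ := {x | ∃ E, MeasurableSet E ∧ E ⊆ A \ B ∧ P.real E ≤ c - P.real B ∧
      P.real E = x} with hS
    have hbdd : BddAbove S := ⟨c - P.real B, by rintro _ ⟨E, -, -, h, rfl⟩; exact h⟩
    have h0S : (0 : ℝ) ∈ S := ⟨∅, by simp, by simp, by simpa using hBc, by simp⟩
    rcases (le_csSup hbdd h0S).eq_or_lt with h | h
    · refine ⟨∅, by simp, by simp, by simpa using hBc, fun E' h1 h2 h3 => ?_⟩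
      have := le_csSup hbdd (⟨E', h1, h2, h3, rfl⟩ : P.real E' ∈ S)
      simpa [← h] using this
    · obtain ⟨_, ⟨E, h1, h2, h3, rfl⟩, h4⟩ := exists_lt_of_lt_csSup ⟨0, h0S⟩ (half_lt_self h)
      refine ⟨E, h1, h2, h3, fun E' h1' h2' h3' => ?_⟩
      have := le_csSup hbdd (⟨E', h1', h2', h3', rfl⟩ : P.real E' ∈ S)
      linarith
  choose E hE hEA hEc hEmax using step
  have hadd : ∀ B : T, P.real (B.1 ∪ E B) = P.real B.1 + P.real (E B) := fun B =>
    measureReal_union (Set.disjoint_left.2 fun x hx hx' => (hEA B hx').2 hx) (hE B)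
  let next : T → T := fun B => ⟨B.1 ∪ E B, B.2.1.union (hE B),
    Set.union_subset B.2.2.1 ((hEA B).trans Set.sdiff_subset), by
      rw [hadd]; linarith [hEc B]⟩
  let b : ℕ → T := fun n => next^[n] ⟨∅, by simp, by simp, by simpa using hc0⟩
  have hb : ∀ n, (b (n + 1)).1 = (b n).1 ∪ E (b n) := fun n => by
    simp only [b, Function.iterate_succ_apply', next]
  have hmono : Monotone fun n => (b n).1 :=
    monotone_nat_of_le_succ fun n => by
      change (b n).1 ⊆ (b (n + 1)).1
      rw [hb]; exact Set.subset_union_left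
  set U : Set Ω := ⋃ n, (b n).1 with hU
  have hUm : MeasurableSet U := MeasurableSet.iUnion fun n => (b n).2.1
  have hlim : Filter.Tendsto (fun n => P.real (b n).1) Filter.atTop (nhds (P.real U)) :=
    (ENNReal.tendsto_toReal (measure_ne_top _ _)).comp (tendsto_measure_iUnion_atTop hmono)
  have hUc : P.real U ≤ c := le_of_tendsto' hlim fun n => (b n).2.2.2
  have hUA : U ⊆ A := Set.iUnion_subset fun n => (b n).2.2.1
  refine ⟨U, hUA, hUm, hUc.eq_of_not_lt fun hlt => ?_⟩
  -- If mass is missing, some `D` of positive measure fits at every stage, so every greedy piece has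
  -- measure at least `P.real D / 2` and the total exceeds `c`.
  obtain ⟨D, hDA, hD, hD0, hD1⟩ := hP.exists_subset_le (hA.diff hUm)
    (by rw [measureReal_sdiff hUA hUm]; linarith) (sub_pos.2 hlt)
  have hle : ∀ n, P.real D ≤ 2 * P.real (E (b n)) := fun n => by
    have hsub : (b n).1 ⊆ U := Set.subset_iUnion (fun n => (b n).1) n
    refine hEmax _ D hD (hDA.trans (Set.sdiff_subset_sdiff_right hsub)) ?_
    have : P.real (b n).1 ≤ P.real U := measureReal_mono hsub
    linarith
  have hgrow : ∀ n : ℕ, n * (P.real D / 2) ≤ P.real (b n).1 := by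
    intro n
    induction n with
    | zero => simp
    | succ n ih =>
      rw [hb, hadd]; push_cast; linarith [hle n]
  obtain ⟨n, hn⟩ := exists_nat_gt (c / (P.real D / 2))
  rw [div_lt_iff₀ (by linarith)] at hn
  linarith [hgrow n, (b n).2.2.2]

end Atomless

/-! ### Independent Bernoulli variables on an atomless space -/

section BernoulliSequence

variable {Ω : Type*} [MeasurableSpace Ω] {P : Measure Ω}

open Classical in
/-- The mass that the Bernoulli distribution with parameter `θ` gives to `D`. -/
noncomputable def bernoulliMass (θ : ℝ) (D : Set Bool) : ℝ :=
  (if true ∈ D then θ else 0) + (if false ∈ D then 1 - θ else 0)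

theorem bernoulliMass_nonneg {θ : ℝ} (hθ : θ ∈ Set.Icc (0 : ℝ) 1) (D : Set Bool) :
    0 ≤ bernoulliMass θ D := by
  have := hθ.1; have := hθ.2
  unfold bernoulliMass; split_ifs <;> linarith

theorem bernoulliMass_le_one {θ : ℝ} (hθ : θ ∈ Set.Icc (0 : ℝ) 1) (D : Set Bool) :
    bernoulliMass θ D ≤ 1 := by
  have := hθ.1; have := hθ.2
  unfold bernoulliMass; split_ifs <;> linarith

/-- Since `Y` is discrete, Sierpiński's theorem cuts the proportion `θ` out of each level set; the
indicator of the union of these cuts is independent of `Y`. -/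
theorem IsAtomless.exists_bernoulli_indep [IsFiniteMeasure P] (hP : IsAtomless P)
    {θ : ℝ} (hθ : θ ∈ Set.Icc (0 : ℝ) 1) {Y : Ω → ℕ} (hY : Measurable Y) :
    ∃ X : Ω → Bool, Measurable X ∧ ∀ (D : Set Bool) (S : Set ℕ),
      P.real (Y ⁻¹' S ∩ X ⁻¹' D) = P.real (Y ⁻¹' S) * bernoulliMass θ D := by
  classical
  have hex : ∀ k : ℕ, ∃ C ⊆ Y ⁻¹' {k}, MeasurableSet C ∧
      P.real C = θ * P.real (Y ⁻¹' {k}) := fun k =>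
    hP.exists_subset_eq (hY (measurableSet_singleton k)) (mul_nonneg hθ.1 measureReal_nonneg)
      (mul_le_of_le_one_left measureReal_nonneg hθ.2)
  choose C hCY hC hCP using hex
  set U : Set Ω := ⋃ k, C k with hU
  have hUm : MeasurableSet U := MeasurableSet.iUnion hC
  have hUk : ∀ k, Y ⁻¹' {k} ∩ U = C k := by
    intro k
    ext ω
    simp only [hU, Set.mem_inter_iff, Set.mem_preimage, Set.mem_singleton_iff, Set.mem_iUnion]
    refine ⟨?_, fun h => ⟨hCY k h, k, h⟩⟩
    rintro ⟨h1, j, h2⟩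
    have : Y ω = j := hCY j h2
    rwa [← h1, this]
  have hmeas : (P.restrict U).map Y = ENNReal.ofReal θ • P.map Y := by
    refine Measure.ext_of_singleton fun k => ?_
    rw [Measure.map_apply hY (measurableSet_singleton k),
      Measure.restrict_apply (hY (measurableSet_singleton k)), hUk, Measure.smul_apply,
      Measure.map_apply hY (measurableSet_singleton k), smul_eq_mul,
      ← ENNReal.ofReal_toReal (measure_ne_top P (C k)),
      ← ENNReal.ofReal_toReal (measure_ne_top P (Y ⁻¹' {k})), ← ENNReal.ofReal_mul hθ.1]
    exact congrArg ENNReal.ofReal (hCP k)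
  have hS : ∀ S : Set ℕ, P.real (Y ⁻¹' S ∩ U) = θ * P.real (Y ⁻¹' S) := by
    intro S
    have hm : MeasurableSet S := MeasurableSet.of_discrete
    have := congrArg (fun μ => (μ S).toReal) hmeas
    simpa [Measure.map_apply hY hm, Measure.restrict_apply (hY hm), hθ.1, Measure.real] using this
  have hSc : ∀ S : Set ℕ, P.real (Y ⁻¹' S ∩ Uᶜ) = (1 - θ) * P.real (Y ⁻¹' S) := by
    intro S
    have := measureReal_inter_add_sdiff (μ := P) (s := Y ⁻¹' S) hUm
    rw [hS, Set.sdiff_eq] at this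
    linarith
  refine ⟨fun ω => decide (ω ∈ U), measurable_to_bool (by
    convert hUm using 1; ext ω; simp), fun D S => ?_⟩
  by_cases h1 : true ∈ D <;> by_cases h2 : false ∈ D
  · have : (fun ω => decide (ω ∈ U)) ⁻¹' D = Set.univ := by
      ext ω; by_cases h : ω ∈ U <;> simp [h, h1, h2]
    rw [this]; simp [bernoulliMass, h1, h2]
  · have : (fun ω => decide (ω ∈ U)) ⁻¹' D = U := by
      ext ω; by_cases h : ω ∈ U <;> simp [h, h1, h2]
    rw [this, hS]; simp [bernoulliMass, h1, h2, mul_comm]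
  · have : (fun ω => decide (ω ∈ U)) ⁻¹' D = Uᶜ := by
      ext ω; by_cases h : ω ∈ U <;> simp [h, h1, h2]
    rw [this, hSc]; simp [bernoulliMass, h1, h2, mul_comm]
  · have : (fun ω => decide (ω ∈ U)) ⁻¹' D = ∅ := by
      ext ω; by_cases h : ω ∈ U <;> simp [h, h1, h2]
    rw [this]; simp [bernoulliMass, h1, h2]

/-- On an atomless space there is a sequence of iid Bernoulli variables that is independent of a
given discrete random variable. -/
theorem IsAtomless.exists_bernoulli_sequence [IsFiniteMeasure P] (hP : IsAtomless P)
    {θ : ℝ} (hθ : θ ∈ Set.Icc (0 : ℝ) 1) {N : Ω → ℕ} (hN : Measurable N) :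
    ∃ X : ℕ → Ω → Bool, (∀ i, Measurable (X i)) ∧
      ∀ (s : Finset ℕ) (D : ℕ → Set Bool) (S : Set ℕ),
        P.real (N ⁻¹' S ∩ ⋂ i ∈ s, X i ⁻¹' D i) =
          P.real (N ⁻¹' S) * ∏ i ∈ s, bernoulliMass θ (D i) := by
  have hex : ∀ Y : {Y : Ω → ℕ // Measurable Y}, ∃ X : Ω → Bool, Measurable X ∧
      ∀ (D : Set Bool) (S : Set ℕ),
        P.real (Y.1 ⁻¹' S ∩ X ⁻¹' D) = P.real (Y.1 ⁻¹' S) * bernoulliMass θ D :=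
    fun Y => hP.exists_bernoulli_indep hθ Y.2
  choose B hB hBP using hex
  -- `Nat.bit` packs the new bit and the whole past into one natural number, so each new variable is
  -- independent of `N` and all earlier bits jointly.
  let next : {Y : Ω → ℕ // Measurable Y} → {Y : Ω → ℕ // Measurable Y} := fun Y =>
    ⟨fun ω => Nat.bit (B Y ω) (Y.1 ω),
      (Measurable.of_discrete (f := fun q : Bool × ℕ => Nat.bit q.1 q.2)).comp ((hB Y).prodMk Y.2)⟩
  let Y : ℕ → {Y : Ω → ℕ // Measurable Y} := fun n => next^[n] ⟨N, hN⟩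
  have hY : ∀ n, (Y (n + 1)).1 = fun ω => Nat.bit (B (Y n) ω) ((Y n).1 ω) := fun n => by
    simp only [Y, Function.iterate_succ_apply', next]
  have hfacN : ∀ n, ∃ g : ℕ → ℕ, ∀ ω, N ω = g ((Y n).1 ω) := by
    intro n
    induction n with
    | zero => exact ⟨id, fun ω => rfl⟩
    | succ n ih =>
      obtain ⟨g, hg⟩ := ih
      exact ⟨fun y => g y.div2, fun ω => by rw [hY, hg]; simp⟩
  have hfacX : ∀ n i, i < n → ∃ g : ℕ → Bool, ∀ ω, B (Y i) ω = g ((Y n).1 ω) := by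
    intro n
    induction n with
    | zero => intro i hi; omega
    | succ n ih =>
      intro i hi
      rcases Nat.lt_succ_iff_lt_or_eq.1 hi with h | rfl
      · obtain ⟨g, hg⟩ := ih i h
        exact ⟨fun y => g y.div2, fun ω => by rw [hY, hg]; simp⟩
      · exact ⟨Nat.bodd, fun ω => by rw [hY]; simp⟩
  refine ⟨fun i => B (Y i), fun i => hB _, fun s D S => ?_⟩
  induction s using Finset.induction_on_max with
  | empty => simp
  | insert n s hs ih =>
    have hn : n ∉ s := fun h => (hs n h).false
    obtain ⟨g, hg⟩ := hfacN n
    have hex' : ∀ i, ∃ g : ℕ → Bool, i ∈ s → ∀ ω, B (Y i) ω = g ((Y n).1 ω) := fun i => by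
      by_cases hi : i ∈ s
      · obtain ⟨g, hg⟩ := hfacX n i (hs i hi)
        exact ⟨g, fun _ => hg⟩
      · exact ⟨fun _ => true, fun h => absurd h hi⟩
    choose G hG using hex'
    have hset : (N ⁻¹' S ∩ ⋂ i ∈ s, B (Y i) ⁻¹' D i) =
        (Y n).1 ⁻¹' {y | g y ∈ S ∧ ∀ i ∈ s, G i y ∈ D i} := by
      ext ω
      simp only [Set.mem_inter_iff, Set.mem_preimage, Set.mem_iInter, Set.mem_ofPred_eq, hg ω]
      refine and_congr_right fun _ => forall₂_congr fun i hi => ?_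
      rw [hG i hi]
    rw [Finset.set_biInter_insert, Set.inter_left_comm, Set.inter_comm (B (Y n) ⁻¹' D n), hset,
      hBP, ← hset, ih, Finset.prod_insert hn]
    ring

end BernoulliSequence

/-! ### Conditional probabilities given a discrete variable -/

section CondExp

variable {Ω : Type*} [mΩ : MeasurableSpace Ω] {P : Measure Ω}

theorem condExp_indicator_ae_eq_of_discrete [IsProbabilityMeasure P] {N : Ω → ℕ} (hN : Measurable N)
    {E : Set Ω} (hE : MeasurableSet E) {g : ℕ → ℝ} (hg : ∀ k, |g k| ≤ 1)
    (h : ∀ k, P.real (N ⁻¹' {k} ∩ E) = P.real (N ⁻¹' {k}) * g k) :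
    P⟦E | MeasurableSpace.comap N ⊤⟧ =ᵐ[P] fun ω => g (N ω) := by
  have hm : MeasurableSpace.comap N ⊤ ≤ mΩ := hN.comap_le
  have hgm : Measurable g := Measurable.of_discrete
  have hgi : ∀ μ : Measure ℕ, IsFiniteMeasure μ → Integrable g μ := fun μ _ =>
    Integrable.of_bound hgm.aestronglyMeasurable 1 (ae_of_all _ hg)
  symm
  refine ae_eq_condExp_of_forall_setIntegral_eq hm
    ((integrable_const (1 : ℝ)).indicator hE) (fun s _ _ => ?_) (fun s hs _ => ?_) ?_
  · exact (Integrable.of_bound (hgm.comp hN).aestronglyMeasurable 1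
      (ae_of_all _ fun ω => hg (N ω))).integrableOn
  · obtain ⟨S, -, rfl⟩ := hs
    have hS : MeasurableSet S := MeasurableSet.of_discrete
    have hlhs : ∫ ω in N ⁻¹' S, g (N ω) ∂P = ∫ k, S.indicator g k ∂(P.map N) := by
      rw [integral_indicator hS, setIntegral_map hS hgm.aestronglyMeasurable hN.aemeasurable]
    have hrhs : ∫ ω in N ⁻¹' S, E.indicator (fun _ => (1 : ℝ)) ω ∂P =
        ∫ k, S.indicator (fun _ => (1 : ℝ)) k ∂((P.restrict E).map N) := by
      rw [integral_indicator hE, integral_indicator hS,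
        setIntegral_map hS aestronglyMeasurable_const hN.aemeasurable,
        Measure.restrict_restrict hE, Measure.restrict_restrict (hN hS), Set.inter_comm]
    have := Measure.isProbabilityMeasure_map (μ := P) hN.aemeasurable
    rw [hlhs, hrhs, integral_countable ((hgi _ inferInstance).indicator hS),
      integral_countable ((integrable_const (1 : ℝ)).indicator hS)]
    refine tsum_congr fun k => ?_
    have hk : MeasurableSet ({k} : Set ℕ) := measurableSet_singleton k
    rw [map_measureReal_apply hN hk, map_measureReal_apply hN hk,
      measureReal_restrict_apply (hN hk), h k]
    by_cases hkS : k ∈ S <;> simp [hkS]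
  · exact (hgm.comp (comap_measurable N)).aestronglyMeasurable

/-- Given `N = k` the terms are the fixed function `f k` of iid bits, so cylinder probabilities
factor into Bernoulli masses that do not depend on the index. -/
theorem isCondIID_of_bernoulli [IsProbabilityMeasure P] {N : Ω → ℕ} (hN : Measurable N)
    {θ : ℝ} (hθ : θ ∈ Set.Icc (0 : ℝ) 1) {X : ℕ → Ω → Bool} (hX : ∀ i, Measurable (X i))
    (h : ∀ (s : Finset ℕ) (D : ℕ → Set Bool) (S : Set ℕ),
        P.real (N ⁻¹' S ∩ ⋂ i ∈ s, X i ⁻¹' D i) =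
          P.real (N ⁻¹' S) * ∏ i ∈ s, bernoulliMass θ (D i)) (f : ℕ → Bool → ℝ) :
    IsCondIID P fun i ω => f (N ω) (X i ω) := by
  have hZ : Measurable fun (ω : Ω) (_ : Fin 1) => (N ω : ℝ) :=
    measurable_pi_lambda _ fun _ => measurable_from_nat.comp hN
  refine ⟨1, fun ω _ => (N ω : ℝ), hZ, ?_⟩
  -- The real vector with entry `N` generates the same σ-algebra as `N`, because `ℕ` embeds
  -- measurably.
  have hcomap : MeasurableSpace.comap (fun (ω : Ω) (_ : Fin 1) => (N ω : ℝ)) inferInstance =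
      MeasurableSpace.comap N ⊤ := by
    have he : MeasurableEmbedding fun (k : ℕ) (_ : Fin 1) => (k : ℝ) :=
      { injective := fun a b hab => by simpa using congrFun hab 0
        measurable := measurable_from_nat
        measurableSet_image' := fun s _ => (s.to_countable.image _).measurableSet }
    rw [show (⊤ : MeasurableSpace ℕ) = Nat.instMeasurableSpace from rfl, ← he.comap_eq]
    exact (MeasurableSpace.comap_comp (f := fun (k : ℕ) (_ : Fin 1) => (k : ℝ)) (g := N)).symm
  rw [hcomap]
  have hL : ∀ i, Measurable fun ω => f (N ω) (X i ω) := fun i =>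
    (Measurable.of_discrete (f := fun q : ℕ × Bool => f q.1 q.2)).comp (hN.prodMk (hX i))
  have key : ∀ (s : Finset ℕ) (B : ℕ → Set ℝ), (∀ i ∈ s, MeasurableSet (B i)) →
      P⟦⋂ i ∈ s, (fun ω => f (N ω) (X i ω)) ⁻¹' B i | MeasurableSpace.comap N ⊤⟧ =ᵐ[P]
        fun ω => ∏ i ∈ s, bernoulliMass θ (f (N ω) ⁻¹' B i) := by
    intro s B hB
    refine condExp_indicator_ae_eq_of_discrete (g := fun k =>
      ∏ i ∈ s, bernoulliMass θ (f k ⁻¹' B i)) hN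
      (Finset.measurableSet_biInter _ fun i hi => hL i (hB i hi)) (fun k => ?_) (fun k => ?_)
    · rw [abs_of_nonneg (Finset.prod_nonneg fun i _ => bernoulliMass_nonneg hθ _)]
      exact Finset.prod_le_one (fun i _ => bernoulliMass_nonneg hθ _)
        fun i _ => bernoulliMass_le_one hθ _
    · rw [← h]
      congr 1
      ext ω
      simp only [Set.mem_inter_iff, Set.mem_preimage, Set.mem_singleton_iff, Set.mem_iInter]
      refine and_congr_right fun hk => forall₂_congr fun i _ => ?_
      rw [hk]
  have key1 : ∀ (i : ℕ) (B : Set ℝ), MeasurableSet B →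
      P⟦(fun ω => f (N ω) (X i ω)) ⁻¹' B | MeasurableSpace.comap N ⊤⟧ =ᵐ[P]
        fun ω => bernoulliMass θ (f (N ω) ⁻¹' B) := fun i B hB => by
    simpa using key {i} (fun _ => B) fun _ _ => hB
  refine ⟨fun s B hB => ?_, fun i j B hB => (key1 i B hB).trans (key1 j B hB).symm⟩
  refine (key s B hB).trans ?_
  have : ∀ᵐ ω ∂P, ∀ i ∈ s, (P⟦(fun ω => f (N ω) (X i ω)) ⁻¹' B i |
      MeasurableSpace.comap N ⊤⟧) ω = bernoulliMass θ (f (N ω) ⁻¹' B i) :=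
    (Finset.eventually_all s).2 fun i hi => key1 i (B i) (hB i hi)
  filter_upwards [this] with ω hω
  rw [Finset.prod_apply]
  exact Finset.prod_congr rfl fun i hi => (hω i hi).symm

end CondExp

/-! ### Exchangeability, convex order and essential infimum -/

section Exchangeable

variable {Ω : Type*} {m : MeasurableSpace Ω} [mΩ : MeasurableSpace Ω] {P : Measure Ω}
  {L : ℕ → Ω → ℝ}

theorem integral_condProb [IsProbabilityMeasure P] (hm : m ≤ mΩ) {E : Set Ω}
    (hE : MeasurableSet E) : ∫ ω, (P⟦E | m⟧) ω ∂P = P.real E := by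
  rw [integral_condExp hm, integral_indicator_const _ hE]
  simp

/-- The right side does not involve `σ`: this is exchangeability on rectangles. -/
theorem IsCondIIDGiven.measureReal_iInter [IsProbabilityMeasure P] (hL : IsCondIIDGiven m P L)
    (hm : m ≤ mΩ) (hLm : ∀ i, Measurable (L i)) {n : ℕ} {σ : Fin n → ℕ} (hσ : σ.Injective)
    {B : Fin n → Set ℝ} (hB : ∀ j, MeasurableSet (B j)) :
    P.real (⋂ j, L (σ j) ⁻¹' B j) = ∫ ω, (∏ j, (P⟦L 0 ⁻¹' B j | m⟧) ω) ∂P := by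
  classical
  set B' : ℕ → Set ℝ := fun i => if h : ∃ j, σ j = i then B h.choose else Set.univ with hB'
  have hB'σ : ∀ j, B' (σ j) = B j := fun j => by
    have h : ∃ j', σ j' = σ j := ⟨j, rfl⟩
    simp only [hB', h, dif_pos]
    rw [hσ h.choose_spec]
  have hind := hL.indep (Finset.univ.image σ) B' (by
    intro i hi
    obtain ⟨j, -, rfl⟩ := Finset.mem_image.1 hi
    rw [hB'σ]; exact hB j)
  have hset : (⋂ i ∈ Finset.univ.image σ, L i ⁻¹' B' i) = ⋂ j, L (σ j) ⁻¹' B j := by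
    ext ω; simp [hB'σ]
  rw [hset, Finset.prod_image fun a _ b _ hab => hσ hab] at hind
  rw [← integral_condProb hm (MeasurableSet.iInter fun j => hLm _ (hB j))]
  refine integral_congr_ae ?_
  have hall : ∀ᵐ ω ∂P, ∀ j, (P⟦L (σ j) ⁻¹' B j | m⟧) ω = (P⟦L 0 ⁻¹' B j | m⟧) ω :=
    ae_all_iff.2 fun j => hL.ident (σ j) 0 (B j) (hB j)
  filter_upwards [hind, hall] with ω h1 h2
  rw [h1, Finset.prod_apply]
  exact Finset.prod_congr rfl fun j _ => by rw [hB'σ, h2]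

theorem IsCondIIDGiven.map_eq [IsProbabilityMeasure P] (hL : IsCondIIDGiven m P L)
    (hm : m ≤ mΩ) (hLm : ∀ i, Measurable (L i)) {n : ℕ} {σ τ : Fin n → ℕ} (hσ : σ.Injective)
    (hτ : τ.Injective) :
    P.map (fun ω j => L (σ j) ω) = P.map (fun ω j => L (τ j) ω) := by
  have hms : ∀ σ : Fin n → ℕ, Measurable fun ω j => L (σ j) ω := fun σ =>
    measurable_pi_lambda _ fun j => hLm _
  have := Measure.isProbabilityMeasure_map (μ := P) (hms σ).aemeasurable
  have := Measure.isProbabilityMeasure_map (μ := P) (hms τ).aemeasurable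
  refine ext_of_generate_finite _ generateFrom_pi.symm isPiSystem_pi ?_ (by simp)
  rintro _ ⟨B, hB, rfl⟩
  have hB' : ∀ j, MeasurableSet (B j) := fun j => hB j (Set.mem_univ j)
  have hpre : ∀ σ : Fin n → ℕ,
      (fun ω j => L (σ j) ω) ⁻¹' (Set.univ.pi B) = ⋂ j, L (σ j) ⁻¹' B j := fun σ => by
    ext ω; simp
  rw [Measure.map_apply (hms σ) (.univ_pi hB'), Measure.map_apply (hms τ) (.univ_pi hB'),
    hpre, hpre, ← measureReal_eq_measureReal_iff, hL.measureReal_iInter hm hLm hσ hB',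
    hL.measureReal_iInter hm hLm hτ hB']

theorem measurable_poolLoss (hLm : ∀ i, Measurable (L i)) (ℓ : ℕ) :
    Measurable (poolLoss L ℓ) := by
  unfold poolLoss
  exact (Finset.measurable_fun_sum _ fun i _ => hLm i).div_const _

theorem poolLoss_mem_unitRV (hL : ∀ i, L i ∈ unitRV Ω) (ℓ : ℕ) : poolLoss L ℓ ∈ unitRV Ω := by
  refine ⟨measurable_poolLoss (fun i => (hL i).1) ℓ, fun ω => ⟨?_, ?_⟩⟩
  · exact div_nonneg (Finset.sum_nonneg fun i _ => ((hL i).2 ω).1) ℓ.cast_nonneg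
  · refine div_le_one_of_le₀ ?_ ℓ.cast_nonneg
    calc ∑ i ∈ Finset.range ℓ, L i ω ≤ ∑ i ∈ Finset.range ℓ, (1 : ℝ) :=
          Finset.sum_le_sum fun i _ => ((hL i).2 ω).2
      _ = ℓ := by simp

theorem integrable_comp_of_mem_unitRV [IsProbabilityMeasure P] {X : Ω → ℝ} (hX : X ∈ unitRV Ω)
    {φ : ℝ → ℝ} (hφ : Continuous φ) : Integrable (fun ω => φ (X ω)) P := by
  obtain ⟨C, hC⟩ := isCompact_Icc.exists_bound_of_continuousOn (hφ.continuousOn (s := Set.Icc 0 1))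
  exact Integrable.of_bound (hφ.measurable.comp hX.1).aestronglyMeasurable C
    (ae_of_all _ fun ω => hC _ (hX.2 ω))

theorem IsCondIIDGiven.integral_comp_poolLoss_succ_le [IsProbabilityMeasure P]
    (hL : IsCondIIDGiven m P L) (hm : m ≤ mΩ) (hLu : ∀ i, L i ∈ unitRV Ω) {φ : ℝ → ℝ}
    (hφ : Continuous φ) (hconv : ConvexOn ℝ Set.univ φ) {ℓ : ℕ} (hℓ : 1 ≤ ℓ) :
    ∫ ω, φ (poolLoss L (ℓ + 1) ω) ∂P ≤ ∫ ω, φ (poolLoss L ℓ ω) ∂P := by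
  have hℓ0 : (0 : ℝ) < ℓ := by exact_mod_cast hℓ
  have hℓ1 : (0 : ℝ) < ℓ + 1 := by linarith
  -- `M j` is the average of the first `ℓ + 1` losses with the `j`-th left out.
  let M : Fin (ℓ + 1) → Ω → ℝ := fun j ω => (∑ i : Fin ℓ, L (j.succAbove i : Fin (ℓ + 1)) ω) / ℓ
  have hM : ∀ j, ∫ ω, φ (M j ω) ∂P = ∫ ω, φ (poolLoss L ℓ ω) ∂P := by
    intro j
    have hlaw := hL.map_eq hm (fun i => (hLu i).1)
      (σ := fun i : Fin ℓ => ((j.succAbove i : Fin (ℓ + 1)) : ℕ)) (τ := fun i : Fin ℓ => (i : ℕ))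
      (Fin.val_injective.comp Fin.succAbove_right_injective) Fin.val_injective
    have hψ : Continuous fun x : Fin ℓ → ℝ => φ ((∑ i, x i) / ℓ) :=
      hφ.comp ((continuous_finsetSum _ fun i _ => continuous_apply i).div_const _)
    have h1 := congrArg (fun μ => ∫ x, φ ((∑ i, x i) / ℓ) ∂μ) hlaw
    rw [integral_map (measurable_pi_lambda _ fun i => (hLu _).1).aemeasurable
        hψ.measurable.aestronglyMeasurable,
      integral_map (measurable_pi_lambda _ fun i => (hLu _).1).aemeasurable
        hψ.measurable.aestronglyMeasurable] at h1
    rw [h1]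
    simp only [poolLoss, Finset.sum_range]
  have hMu : ∀ j, M j ∈ unitRV Ω := by
    intro j
    refine ⟨(Finset.measurable_fun_sum _ fun i _ => (hLu _).1).div_const _, fun ω => ⟨?_, ?_⟩⟩
    · exact div_nonneg (Finset.sum_nonneg fun i _ => ((hLu _).2 ω).1) hℓ0.le
    · refine div_le_one_of_le₀ ?_ hℓ0.le
      calc ∑ i : Fin ℓ, L (j.succAbove i : Fin (ℓ + 1)) ω ≤ ∑ i : Fin ℓ, (1 : ℝ) :=
            Finset.sum_le_sum fun i _ => ((hLu _).2 ω).2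
        _ = ℓ := by simp
  have hpt : ∀ ω, φ (poolLoss L (ℓ + 1) ω) ≤ ∑ j, (1 / (ℓ + 1 : ℝ)) * φ (M j ω) := by
    intro ω
    have havg : poolLoss L (ℓ + 1) ω = ∑ j, (1 / (ℓ + 1 : ℝ)) • M j ω := by
      have hloo : ∀ j : Fin (ℓ + 1), ∑ i : Fin ℓ, L (j.succAbove i : Fin (ℓ + 1)) ω =
          (∑ k : Fin (ℓ + 1), L k ω) - L j ω := fun j => by
        rw [Fin.sum_univ_succAbove (fun k : Fin (ℓ + 1) => L k ω) j]; ring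
      simp only [M, hloo, poolLoss, Finset.sum_range, smul_eq_mul]
      rw [← Finset.mul_sum, ← Finset.sum_div, Finset.sum_sub_distrib]
      simp only [Finset.sum_const, Finset.card_univ, Fintype.card_fin, nsmul_eq_mul]
      push_cast
      field_simp
      ring
    rw [havg]
    refine hconv.map_sum_le (fun j _ => by positivity) ?_ (fun j _ => Set.mem_univ _)
    simp only [Finset.sum_const, Finset.card_univ, Fintype.card_fin, nsmul_eq_mul]
    push_cast
    field_simp
  calc ∫ ω, φ (poolLoss L (ℓ + 1) ω) ∂P ≤ ∫ ω, ∑ j, (1 / (ℓ + 1 : ℝ)) * φ (M j ω) ∂P :=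
        integral_mono (integrable_comp_of_mem_unitRV (poolLoss_mem_unitRV hLu _) hφ)
          (integrable_finsetSum _ fun j _ =>
            (integrable_comp_of_mem_unitRV (hMu j) hφ).const_mul _) hpt
    _ = ∑ j : Fin (ℓ + 1), (1 / (ℓ + 1 : ℝ)) * ∫ ω, φ (poolLoss L ℓ ω) ∂P := by
        rw [integral_finsetSum _ fun j _ =>
          (integrable_comp_of_mem_unitRV (hMu j) hφ).const_mul _]
        exact Finset.sum_congr rfl fun j _ => by rw [integral_const_mul, hM]
    _ = ∫ ω, φ (poolLoss L ℓ ω) ∂P := by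
        simp only [Finset.sum_const, Finset.card_univ, Fintype.card_fin, nsmul_eq_mul]
        push_cast
        field_simp

/-- Pooling a conditionally iid sequence decreases the risk in convex order. -/
theorem IsCondIIDGiven.integral_comp_poolLoss_le [IsProbabilityMeasure P]
    (hL : IsCondIIDGiven m P L) (hm : m ≤ mΩ) (hLu : ∀ i, L i ∈ unitRV Ω) {φ : ℝ → ℝ}
    (hφ : Continuous φ) (hconv : ConvexOn ℝ Set.univ φ) {ℓ ℓ' : ℕ} (hℓ : 1 ≤ ℓ) (hℓ' : ℓ ≤ ℓ') :
    ∫ ω, φ (poolLoss L ℓ' ω) ∂P ≤ ∫ ω, φ (poolLoss L ℓ ω) ∂P := by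
  induction ℓ', hℓ' using Nat.le_induction with
  | base => exact le_rfl
  | succ k hk ih =>
    exact (hL.integral_comp_poolLoss_succ_le hm hLu hφ hconv (hℓ.trans hk)).trans ih

/-- Pooling a conditionally iid sequence does not change the essential infimum. -/
theorem IsCondIIDGiven.ae_lt_poolLoss_iff [IsProbabilityMeasure P]
    (hL : IsCondIIDGiven m P L) (hm : m ≤ mΩ) (hLm : ∀ i, Measurable (L i)) {ℓ : ℕ} (hℓ : 1 ≤ ℓ)
    (y : ℝ) : (∀ᵐ ω ∂P, y < poolLoss L ℓ ω) ↔ ∀ᵐ ω ∂P, y < L 0 ω := by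
  have hℓ0 : (0 : ℝ) < ℓ := by exact_mod_cast hℓ
  have hq0 : 0 ≤ᵐ[P] P⟦L 0 ⁻¹' Set.Iic y | m⟧ :=
    condExp_nonneg (ae_of_all _ fun ω => Set.indicator_nonneg (fun _ _ => zero_le_one) ω)
  have hmeas0 : MeasurableSet (L 0 ⁻¹' Set.Iic y) := hLm 0 measurableSet_Iic
  constructor
  · intro h
    -- With `q` the conditional probability of `L 0 ≤ y`, the first `ℓ` losses are all at most `y`
    -- with probability `E[q ^ ℓ]`. On that event the pool loss is at most `y`, so `E[q ^ ℓ] = 0`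
    -- and `q = 0` almost surely.
    have hint := hL.measureReal_iInter hm hLm (σ := fun i : Fin ℓ => (i : ℕ)) Fin.val_injective
      (B := fun _ => Set.Iic y) fun _ => measurableSet_Iic
    have hzero : P.real (⋂ j : Fin ℓ, L (j : ℕ) ⁻¹' Set.Iic y) = 0 := by
      rw [measureReal_eq_zero_iff]
      refine measure_mono_null ?_ (ae_iff.1 h)
      intro ω hω
      simp only [Set.mem_iInter, Set.mem_preimage, Set.mem_Iic] at hω
      change ¬ y < poolLoss L ℓ ω
      rw [not_lt, poolLoss, div_le_iff₀ hℓ0, Finset.sum_range]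
      calc ∑ i : Fin ℓ, L i ω ≤ ∑ _i : Fin ℓ, y := Finset.sum_le_sum fun i _ => hω i
        _ = y * ℓ := by simp [mul_comm]
    rw [hzero] at hint
    simp only [Finset.prod_const, Finset.card_univ, Fintype.card_fin] at hint
    have hle1 : ∀ᵐ ω ∂P, (P⟦L 0 ⁻¹' Set.Iic y | m⟧) ω ≤ 1 := by
      have h1 := condExp_mono (m := m) (μ := P) ((integrable_const (1 : ℝ)).indicator hmeas0)
        (integrable_const (1 : ℝ)) (ae_of_all _ fun ω =>
          Set.indicator_le_self' (f := fun _ => (1 : ℝ)) (fun _ _ => zero_le_one) ω)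
      rw [condExp_const hm] at h1
      exact h1
    have hpow : Integrable (fun ω => ((P⟦L 0 ⁻¹' Set.Iic y | m⟧) ω) ^ ℓ) P := by
      refine Integrable.of_bound
        (integrable_condExp.aestronglyMeasurable.pow ℓ) 1 ?_
      filter_upwards [hq0, hle1] with ω h0 h1
      rw [Real.norm_of_nonneg (pow_nonneg h0 _)]
      exact pow_le_one₀ h0 h1
    have hae := (integral_eq_zero_iff_of_nonneg_ae
      (hq0.mono fun ω h0 => pow_nonneg h0 ℓ) hpow).1 hint.symm
    have hP0 : P.real (L 0 ⁻¹' Set.Iic y) = 0 := by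
      rw [← integral_condProb hm hmeas0]
      refine integral_eq_zero_of_ae (hae.mono fun ω hω => ?_)
      exact eq_zero_of_pow_eq_zero hω
    rw [measureReal_eq_zero_iff] at hP0
    rw [ae_iff]
    convert hP0 using 2
    ext ω; simp
  · intro h
    have hall : ∀ᵐ ω ∂P, ∀ i, y < L i ω := by
      refine ae_all_iff.2 fun i => ?_
      have hi : P.real (L i ⁻¹' Set.Iic y) = P.real (L 0 ⁻¹' Set.Iic y) := by
        rw [← integral_condProb hm (hLm i measurableSet_Iic), ← integral_condProb hm hmeas0]
        exact integral_congr_ae (hL.ident i 0 _ measurableSet_Iic)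
      have h0 : P (L 0 ⁻¹' Set.Iic y) = 0 := by
        convert ae_iff.1 h using 2
        ext ω; simp
      rw [measureReal_eq_measureReal_iff, h0] at hi
      rw [ae_iff]
      convert hi using 2
      ext ω; simp
    filter_upwards [hall] with ω hω
    rw [poolLoss, lt_div_iff₀ hℓ0]
    calc y * ℓ = ∑ _i ∈ Finset.range ℓ, y := by simp [mul_comm]
      _ < ∑ i ∈ Finset.range ℓ, L i ω :=
        Finset.sum_lt_sum_of_nonempty (Finset.nonempty_range_iff.2 (by omega)) fun i _ => hω i

end Exchangeable

/-! ### From ordered tail integrals to concave distortions -/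

section StochasticOrder

/-- Up to a null set, an upper set meets `(0, 1]` in some `Ioc t 1`. -/
theorem setIntegral_upper_nonneg {D : ℝ → ℝ} (hD : ∀ t ∈ Set.Icc (0 : ℝ) 1,
    0 ≤ ∫ x in Set.Ioc t 1, D x) {A : Set ℝ} (hA : IsUpperSet A) :
    0 ≤ ∫ x in Set.Ioc 0 1 ∩ A, D x := by
  rcases (Set.Ioc (0 : ℝ) 1 ∩ A).eq_empty_or_nonempty with h | h
  · simp [h]
  set t := sInf (Set.Ioc (0 : ℝ) 1 ∩ A) with ht
  have hbdd : BddBelow (Set.Ioc (0 : ℝ) 1 ∩ A) := ⟨0, fun x hx => hx.1.1.le⟩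
  have ht0 : 0 ≤ t := le_csInf h fun x hx => hx.1.1.le
  have ht1 : t ≤ 1 := by
    obtain ⟨x, hx⟩ := h
    exact (csInf_le hbdd hx).trans hx.1.2
  have h1 : Set.Ioc t 1 ⊆ Set.Ioc (0 : ℝ) 1 ∩ A := fun x hx => by
    obtain ⟨y, hy, hyx⟩ := exists_lt_of_csInf_lt h hx.1
    exact ⟨⟨ht0.trans_lt hx.1, hx.2⟩, hA hyx.le hy.2⟩
  have h2 : Set.Ioc (0 : ℝ) 1 ∩ A ⊆ Set.Icc t 1 := fun x hx => ⟨csInf_le hbdd hx, hx.1.2⟩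
  have hae : (Set.Ioc (0 : ℝ) 1 ∩ A : Set ℝ) =ᵐ[volume] Set.Ioc t 1 :=
    (h2.eventuallyLE.trans Ioc_ae_eq_Icc.symm.le).antisymm h1.eventuallyLE
  rw [setIntegral_congr_set hae]
  exact hD t ⟨ht0, ht1⟩

/-- If all tail integrals of `D` on `(0, 1]` are nonnegative then so is its integral against a
nondecreasing nonnegative weight. -/
theorem setIntegral_monotone_mul_nonneg {D ψ : ℝ → ℝ} (hDm : Measurable D) {M : ℝ}
    (hDM : ∀ x, |D x| ≤ M) (hD : ∀ t ∈ Set.Icc (0 : ℝ) 1, 0 ≤ ∫ x in Set.Ioc t 1, D x)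
    (hψ : Monotone ψ) {c : ℝ} (hψc : ∀ x, ψ x ∈ Set.Icc 0 c) :
    0 ≤ ∫ x in Set.Ioc 0 1, ψ x * D x := by
  have hψm : Measurable ψ := hψ.measurable
  have hset : MeasurableSet {q : ℝ × ℝ | q.2 < ψ q.1} :=
    measurableSet_lt measurable_snd (hψm.comp measurable_fst)
  -- Layer cake: `ψ x` is the length of `{u ∈ (0, c] | u < ψ x}`. After Fubini each level `u`
  -- contributes the integral of `D` over an upper set.
  let K : ℝ → ℝ → ℝ := fun x u => {q : ℝ × ℝ | q.2 < ψ q.1}.indicator (fun q => D q.1) (x, u)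
  have hKm : Measurable (Function.uncurry K) := (hDm.comp measurable_fst).indicator hset
  have hKint : Integrable (Function.uncurry K)
      ((volume.restrict (Set.Ioc 0 1)).prod (volume.restrict (Set.Ioc 0 c))) := by
    refine Integrable.of_bound hKm.aestronglyMeasurable M (ae_of_all _ fun q => ?_)
    exact (norm_indicator_le_norm_self (fun q : ℝ × ℝ => D q.1) q).trans (hDM q.1)
  have hswap := integral_integral_swap hKint
  have hinner : ∀ x, ∫ u in Set.Ioc 0 c, K x u = ψ x * D x := by
    intro x
    have h1 : ∀ u, K x u = (Set.Iio (ψ x)).indicator (fun _ => D x) u := fun u => by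
      simp only [K, Set.indicator_apply, Set.mem_ofPred_eq, Set.mem_Iio]
    simp only [h1]
    rw [setIntegral_indicator measurableSet_Iio, setIntegral_const, smul_eq_mul]
    congr 1
    have h2 : (Set.Ioc 0 c ∩ Set.Iio (ψ x) : Set ℝ) =  Set.Ioo 0 (ψ x) := by
      ext u
      simp only [Set.mem_inter_iff, Set.mem_Ioc, Set.mem_Iio, Set.mem_Ioo]
      have := (hψc x).2
      constructor
      · rintro ⟨⟨h, -⟩, h'⟩; exact ⟨h, h'⟩
      · rintro ⟨h, h'⟩; exact ⟨⟨h, by linarith⟩, h'⟩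
    rw [h2, Real.volume_real_Ioo_of_le (hψc x).1, sub_zero]
  simp only [hinner] at hswap
  rw [hswap]
  refine integral_nonneg fun u => ?_
  have hA : IsUpperSet {x | u < ψ x} := fun a b hab (ha : u < ψ a) => ha.trans_le (hψ hab)
  have h1 : ∀ x, K x u = {x | u < ψ x}.indicator D x := fun x => by
    simp only [K, Set.indicator_apply, Set.mem_ofPred_eq]
  simp only [h1]
  rw [setIntegral_indicator (measurableSet_lt measurable_const hψm)]
  exact setIntegral_upper_nonneg hD hA

/-- A concave function of bounded slope on `[0, 1)` has a nonincreasing choice of supergradients;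
it is extended by zero to the end point. -/
theorem exists_antitoneOn_supergradient {g : ℝ → ℝ} (hg : ConcaveOn ℝ (Set.Ico 0 1) g)
    (hmono : MonotoneOn g (Set.Icc 0 1)) (h0 : g 0 = 0) {c : ℝ}
    (hc : ∀ x ∈ Set.Ico (0 : ℝ) 1, g x ≤ c * x) :
    ∃ φ : ℝ → ℝ, AntitoneOn φ (Set.Icc 0 1) ∧ (∀ a ∈ Set.Icc (0 : ℝ) 1, φ a ∈ Set.Icc 0 c) ∧
      ∀ a ∈ Set.Ico (0 : ℝ) 1, ∀ b ∈ Set.Ico (0 : ℝ) 1, g b ≤ g a + φ a * (b - a) := by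
  have hc0 : 0 ≤ c := by
    have h1 := hc (1 / 2) ⟨by norm_num, by norm_num⟩
    have h2 : g 0 ≤ g (1 / 2) := hmono ⟨le_rfl, zero_le_one⟩ ⟨by norm_num, by norm_num⟩
      (by norm_num)
    rw [h0] at h2
    linarith
  let S : ℝ → Set ℝ := fun a => (fun b => (g b - g a) / (b - a)) '' Set.Ioo a 1
  have hslope : ∀ a ∈ Set.Ico (0 : ℝ) 1, ∀ x ∈ S a, x ≤ c := by
    -- Slopes decrease, so a slope to the right of `a > 0` is at most the slope over `[0, a]`, which
    -- `c` bounds.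
    rintro a ha _ ⟨b, hb, rfl⟩
    dsimp only
    have hb' : b ∈ Set.Ico (0 : ℝ) 1 := ⟨ha.1.trans hb.1.le, hb.2⟩
    rcases ha.1.eq_or_lt with h | h
    · rw [← h, h0, sub_zero, sub_zero, div_le_iff₀ (by rw [h]; exact hb.1)]
      exact hc b hb'
    · refine (hg.slope_anti_adjacent (x := 0) ⟨le_rfl, zero_lt_one⟩ hb' h hb.1).trans ?_
      rw [h0, sub_zero, sub_zero, div_le_iff₀ h]
      exact hc a ha
  have hbdd : ∀ a ∈ Set.Ico (0 : ℝ) 1, BddAbove (S a) := fun a ha => ⟨c, hslope a ha⟩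
  have hne : ∀ a ∈ Set.Ico (0 : ℝ) 1, (S a).Nonempty := fun a ha =>
    (Set.nonempty_Ioo.2 ha.2).image _
  let φ : ℝ → ℝ := fun a => if a < 1 then sSup (S a) else 0
  have hφ : ∀ a ∈ Set.Ico (0 : ℝ) 1, φ a = sSup (S a) := fun a ha => if_pos ha.2
  have hφ0 : ∀ a ∈ Set.Ico (0 : ℝ) 1, 0 ≤ φ a := by
    intro a ha
    rw [hφ a ha]
    obtain ⟨x, hx⟩ := hne a ha
    refine le_trans ?_ (le_csSup (hbdd a ha) hx)
    obtain ⟨b, hb, rfl⟩ := hx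
    exact div_nonneg (sub_nonneg.2 (hmono ⟨ha.1, ha.2.le⟩ ⟨ha.1.trans hb.1.le, hb.2.le⟩ hb.1.le))
      (sub_nonneg.2 hb.1.le)
  have hge : ∀ a ∈ Set.Ico (0 : ℝ) 1, ∀ b ∈ Set.Ioo a 1, (g b - g a) / (b - a) ≤ φ a :=
    fun a ha b hb => by
      rw [hφ a ha]; exact le_csSup (hbdd a ha) ⟨b, hb, rfl⟩
  have hle : ∀ a ∈ Set.Ico (0 : ℝ) 1, ∀ b ∈ Set.Ico (0 : ℝ) a,
      φ a ≤ (g a - g b) / (a - b) := by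
    intro a ha b hb
    rw [hφ a ha]
    refine csSup_le (hne a ha) ?_
    rintro _ ⟨z, hz, rfl⟩
    exact hg.slope_anti_adjacent ⟨hb.1, hb.2.trans ha.2⟩ ⟨ha.1.trans hz.1.le, hz.2⟩ hb.2 hz.1
  refine ⟨φ, ?_, ?_, ?_⟩
  · intro a ha b hb hab
    rcases hab.eq_or_lt with rfl | hab
    · exact le_rfl
    have ha1 : a ∈ Set.Ico (0 : ℝ) 1 := ⟨ha.1, hab.trans_le hb.2⟩
    rcases hb.2.eq_or_lt with rfl | hb1
    · have : φ 1 = 0 := if_neg (lt_irrefl _)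
      rw [this]; exact hφ0 a ha1
    · exact (hle b ⟨hb.1, hb1⟩ a ⟨ha.1, hab⟩).trans (hge a ha1 b ⟨hab, hb1⟩)
  · intro a ha
    rcases ha.2.eq_or_lt with rfl | h1
    · have : φ 1 = 0 := if_neg (lt_irrefl _)
      rw [this]; exact ⟨le_rfl, hc0⟩
    · refine ⟨hφ0 a ⟨ha.1, h1⟩, ?_⟩
      rw [hφ a ⟨ha.1, h1⟩]
      exact csSup_le (hne a ⟨ha.1, h1⟩) (hslope a ⟨ha.1, h1⟩)
  · intro a ha b hb
    rcases lt_trichotomy a b with h | rfl | h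
    · have := hge a ha b ⟨h, hb.2⟩
      rw [div_le_iff₀ (sub_pos.2 h)] at this
      linarith
    · simp
    · have := hle a ha b ⟨hb.1, h⟩
      rw [le_div_iff₀ (sub_pos.2 h)] at this
      linarith

theorem integrableOn_comp_antitone {g F : ℝ → ℝ} (hg : MonotoneOn g (Set.Icc 0 1))
    (hF : Antitone F) (hF01 : ∀ x, F x ∈ Set.Icc (0 : ℝ) 1) :
    IntegrableOn (fun x => g (F x)) (Set.Ioc 0 1) := by
  have hanti : Antitone fun x => g (F x) := fun x y hxy => hg (hF01 y) (hF01 x) (hF hxy)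
  refine (hanti.antitoneOn (Set.Icc 0 1)).integrableOn_isCompact isCompact_Icc |>.mono_set
    Set.Ioc_subset_Icc_self

theorem setIntegral_concave_comp_le_of_slope_le {g F G : ℝ → ℝ}
    (hg : ConcaveOn ℝ (Set.Ico 0 1) g) (hmono : MonotoneOn g (Set.Icc 0 1)) (h0 : g 0 = 0) {c : ℝ}
    (hc : ∀ x ∈ Set.Ico (0 : ℝ) 1, g x ≤ c * x) (hF : Antitone F) (hG : Antitone G)
    (hF01 : ∀ x, F x ∈ Set.Icc (0 : ℝ) 1) (hG01 : ∀ x, G x ∈ Set.Icc (0 : ℝ) 1)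
    (hone : ∀ x ∈ Set.Ioc (0 : ℝ) 1, F x = 1 ↔ G x = 1)
    (htail : ∀ t ∈ Set.Icc (0 : ℝ) 1, ∫ x in Set.Ioc t 1, G x ≤ ∫ x in Set.Ioc t 1, F x) :
    ∫ x in Set.Ioc 0 1, g (G x) ≤ ∫ x in Set.Ioc 0 1, g (F x) := by
  obtain ⟨φ, hφ, hφc, hsup⟩ := exists_antitoneOn_supergradient hg hmono h0 hc
  have hψ : Monotone fun x => φ (F x) := fun x y hxy => hφ (hF01 y) (hF01 x) (hF hxy)
  have hbound : ∀ x, |F x - G x| ≤ 1 := fun x => by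
    have h1 := hF01 x; have h2 := hG01 x
    rw [abs_le]; constructor <;> linarith [h1.1, h1.2, h2.1, h2.2]
  have hFi : ∀ t, IntegrableOn F (Set.Ioc t 1) := fun t =>
    ((hF.antitoneOn (Set.Icc t 1)).integrableOn_isCompact isCompact_Icc).mono_set
      Set.Ioc_subset_Icc_self
  have hGi : ∀ t, IntegrableOn G (Set.Ioc t 1) := fun t =>
    ((hG.antitoneOn (Set.Icc t 1)).integrableOn_isCompact isCompact_Icc).mono_set
      Set.Ioc_subset_Icc_self
  have hnonneg := setIntegral_monotone_mul_nonneg (D := fun x => F x - G x)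
    (hF.measurable.sub hG.measurable) hbound (fun t ht => by
      rw [integral_sub (hFi t) (hGi t)]
      linarith [htail t ht]) hψ fun x => hφc _ (hF01 x)
  have hgF := integrableOn_comp_antitone hmono hF hF01
  have hgG := integrableOn_comp_antitone hmono hG hG01
  have hprod : IntegrableOn (fun x => φ (F x) * (F x - G x)) (Set.Ioc 0 1) := by
    refine Integrable.of_bound
      (hψ.measurable.mul (hF.measurable.sub hG.measurable)).aestronglyMeasurable c
      (ae_of_all _ fun x => ?_)
    have h1 := hφc _ (hF01 x)
    rw [norm_mul, Real.norm_of_nonneg h1.1]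
    calc φ (F x) * ‖F x - G x‖ ≤ φ (F x) * 1 :=
          mul_le_mul_of_nonneg_left (hbound x) h1.1
      _ ≤ c := by rw [mul_one]; exact h1.2
  have hle : ∫ x in Set.Ioc 0 1, φ (F x) * (F x - G x) ≤
      ∫ x in Set.Ioc 0 1, (g (F x) - g (G x)) := by
    refine setIntegral_mono_on hprod (hgF.sub hgG) measurableSet_Ioc fun x hx => ?_
    -- Where one survival function is `1` both are and the two sides vanish; elsewhere both values
    -- lie in `[0, 1)`, where the supergradient inequality holds.
    by_cases h1 : F x = 1
    · rw [h1, (hone x hx).1 h1]; simp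
    · have h2 : G x ≠ 1 := fun h => h1 ((hone x hx).2 h)
      have := hsup (F x) ⟨(hF01 x).1, (hF01 x).2.lt_of_ne h1⟩ (G x)
        ⟨(hG01 x).1, (hG01 x).2.lt_of_ne h2⟩
      linarith
  rw [integral_sub hgF hgG] at hle
  linarith

/-- The increasing concave order carries over to distortion functions that are concave on `[0, 1)`
but may jump at `1`, provided that the survival functions reach `1` at the same points. -/
theorem IsDistortionFunction.setIntegral_comp_le {h F G : ℝ → ℝ} (hh : IsDistortionFunction h)
    (hconc : ConcaveOn ℝ (Set.Ico 0 1) h) (hF : Antitone F) (hG : Antitone G)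
    (hF01 : ∀ x, F x ∈ Set.Icc (0 : ℝ) 1) (hG01 : ∀ x, G x ∈ Set.Icc (0 : ℝ) 1)
    (hone : ∀ x ∈ Set.Ioc (0 : ℝ) 1, F x = 1 ↔ G x = 1)
    (htail : ∀ t ∈ Set.Icc (0 : ℝ) 1, ∫ x in Set.Ioc t 1, G x ≤ ∫ x in Set.Ioc t 1, F x) :
    ∫ x in Set.Ioc 0 1, h (G x) ≤ ∫ x in Set.Ioc 0 1, h (F x) := by
  have h01 : ∀ p ∈ Set.Icc (0 : ℝ) 1, h p ∈ Set.Icc (0 : ℝ) 1 := fun p hp =>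
    ⟨hh.map_zero ▸ hh.monotoneOn ⟨le_rfl, zero_le_one⟩ hp hp.1,
      hh.map_one ▸ hh.monotoneOn hp ⟨zero_le_one, le_rfl⟩ hp.2⟩
  -- Truncation bounds the slope at `0`; at each fixed `p` in `[0, 1]`, `g n p = h p` for all large
  -- `n`.
  let g : ℕ → ℝ → ℝ := fun n p => min (h p) (n * p)
  have hgmono : ∀ n, MonotoneOn (g n) (Set.Icc 0 1) := fun n p hp q hq hpq =>
    min_le_min (hh.monotoneOn hp hq hpq) (mul_le_mul_of_nonneg_left hpq n.cast_nonneg)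
  have hlin : ∀ n : ℕ, ConcaveOn ℝ (Set.Ico (0 : ℝ) 1) fun p => (n : ℝ) * p := fun n =>
    ((concaveOn_id (convex_Ico 0 1)).smul n.cast_nonneg)
  have hstep : ∀ n, ∫ x in Set.Ioc 0 1, g n (G x) ≤ ∫ x in Set.Ioc 0 1, g n (F x) := fun n =>
    setIntegral_concave_comp_le_of_slope_le (hconc.inf (hlin n)) (hgmono n)
      (by simp [g, hh.map_zero]) (c := n) (fun x _ => min_le_right _ _) hF hG hF01 hG01 hone htail
  have hlim : ∀ {H : ℝ → ℝ}, Antitone H → (∀ x, H x ∈ Set.Icc (0 : ℝ) 1) →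
      Filter.Tendsto (fun n => ∫ x in Set.Ioc 0 1, g n (H x)) Filter.atTop
        (nhds (∫ x in Set.Ioc 0 1, h (H x))) := by
    intro H hH hH01
    refine tendsto_integral_of_dominated_convergence (fun _ => (1 : ℝ))
      (fun n => (integrableOn_comp_antitone (hgmono n) hH hH01).aestronglyMeasurable)
      (integrable_const _) (fun n => ae_of_all _ fun x => ?_) (ae_of_all _ fun x => ?_)
    · have h1 := h01 _ (hH01 x)
      rw [Real.norm_of_nonneg (le_min h1.1 (mul_nonneg n.cast_nonneg (hH01 x).1))]
      exact (min_le_left _ _).trans h1.2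
    · refine tendsto_const_nhds.congr' ?_
      rcases (hH01 x).1.eq_or_lt with h0 | h0
      · exact Filter.Eventually.of_forall fun n => by simp [g, ← h0, hh.map_zero]
      · obtain ⟨N, hN⟩ := exists_nat_gt (h (H x) / H x)
        filter_upwards [Filter.eventually_ge_atTop N] with n hn
        refine (min_eq_left ?_).symm
        rw [div_lt_iff₀ h0] at hN
        exact hN.le.trans (mul_le_mul_of_nonneg_right (by exact_mod_cast hn) h0.le)
  exact le_of_tendsto_of_tendsto' (hlim hG hG01) (hlim hF hF01) hstep

end StochasticOrder

/-! ### Distortion risk measures through survival functions -/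

section Choquet

variable {Ω : Type*} [MeasurableSpace Ω] {P : Measure Ω}

theorem unitRV_subset_boundedRV : unitRV Ω ⊆ boundedRV Ω := fun _ hX =>
  ⟨hX.1, 1, fun ω => abs_le.2 ⟨by linarith [(hX.2 ω).1], (hX.2 ω).2⟩⟩

theorem setIntegral_Ioi_survival {X : Ω → ℝ} (hX : X ∈ unitRV Ω) {f : Set Ω → ℝ} (hf : f ∅ = 0) :
    ∫ x in Set.Ioi (0 : ℝ), f {ω | x < X ω} = ∫ x in Set.Ioc 0 1, f {ω | x < X ω} := by
  refine setIntegral_eq_of_subset_of_forall_sdiff_eq_zero measurableSet_Ioi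
    Set.Ioc_subset_Ioi_self fun x hx => ?_
  have h1 : 1 < x := by
    by_contra h
    exact hx.2 ⟨hx.1, not_lt.1 h⟩
  have : {ω | x < X ω} = ∅ := Set.eq_empty_of_forall_notMem fun ω hω =>
    absurd (hω : x < X ω) (not_lt.2 ((hX.2 ω).2.trans h1.le))
  rw [this, hf]

theorem IsDistortionRiskMeasure.eq_setIntegral [IsProbabilityMeasure P] {h : ℝ → ℝ}
    {ρ : (Ω → ℝ) → ℝ} (hρ : IsDistortionRiskMeasure P h ρ) {X : Ω → ℝ} (hX : X ∈ unitRV Ω) :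
    ρ X = ∫ x in Set.Ioc 0 1, h (P.real {ω | x < X ω}) := by
  rw [hρ.eq_choquet X (unitRV_subset_boundedRV hX), choquetIntegral,
    setIntegral_Ioi_survival hX (f := fun A => h (P.real A)) (by simp [hρ.distortion.map_zero])]
  have : ∫ x in Set.Iio (0 : ℝ), (h (P.real {ω | x < X ω}) - 1) = 0 := by
    refine setIntegral_eq_zero_of_forall_eq_zero fun x hx => ?_
    have : {ω | x < X ω} = Set.univ := Set.eq_univ_of_forall fun ω =>
      (show x < 0 from hx).trans_le (hX.2 ω).1
    rw [this, probReal_univ, hρ.distortion.map_one, sub_self]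
  rw [this, add_zero]

theorem antitone_survival [IsFiniteMeasure P] (X : Ω → ℝ) :
    Antitone fun x => P.real {ω | x < X ω} := fun _ _ hxy =>
  measureReal_mono fun _ hω => hxy.trans_lt hω

/-- The variable `max X t` has survival function `1` below `t` and that of `X` above. Tail integrals
thus become expectations of convex functions of `X`. -/
theorem setIntegral_survival_eq [IsProbabilityMeasure P] {X : Ω → ℝ} (hX : X ∈ unitRV Ω) {t : ℝ}
    (ht : t ∈ Set.Icc (0 : ℝ) 1) :
    ∫ x in Set.Ioc t 1, P.real {ω | x < X ω} = ∫ ω, max (X ω) t ∂P - t := by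
  have hXt : (fun ω => max (X ω) t) ∈ unitRV Ω :=
    ⟨hX.1.max measurable_const, fun ω => ⟨le_max_of_le_right ht.1, max_le (hX.2 ω).2 ht.2⟩⟩
  have hXi : Integrable (fun ω => max (X ω) t) P :=
    integrable_comp_of_mem_unitRV hXt continuous_id
  rw [hXi.integral_eq_integral_meas_lt (ae_of_all _ fun ω => (hXt.2 ω).1),
    setIntegral_Ioi_survival hXt (f := P.real) (by simp),
    ← Set.Ioc_union_Ioc_eq_Ioc ht.1 ht.2]
  have hint : ∀ a b, IntegrableOn (fun x => P.real {ω | x < max (X ω) t}) (Set.Ioc a b) :=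
    fun a b => (((antitone_survival _).antitoneOn (Set.Icc a b)).integrableOn_isCompact
      isCompact_Icc).mono_set Set.Ioc_subset_Icc_self
  rw [setIntegral_union (Set.Ioc_disjoint_Ioc_of_le le_rfl) measurableSet_Ioc (hint _ _) (hint _ _)]
  have h1 : ∫ x in Set.Ioc 0 t, P.real {ω | x < max (X ω) t} = t := by
    rw [integral_Ioc_eq_integral_Ioo, setIntegral_congr_fun measurableSet_Ioo
      (g := fun _ => (1 : ℝ)) fun x hx => ?_]
    · simp [ht.1]
    · have : {ω | x < max (X ω) t} = Set.univ :=
        Set.eq_univ_of_forall fun ω => lt_max_of_lt_right hx.2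
      simp only [this, probReal_univ]
  have h2 : ∫ x in Set.Ioc t 1, P.real {ω | x < max (X ω) t} =
      ∫ x in Set.Ioc t 1, P.real {ω | x < X ω} := by
    refine setIntegral_congr_fun measurableSet_Ioc fun x hx => ?_
    have : ∀ ω, x < max (X ω) t ↔ x < X ω := fun ω => by
      rw [lt_max_iff, or_iff_left (not_lt.2 hx.1.le)]
    simp only [this]
  rw [h1, h2]; ring

end Choquet

/-! ### Concavity implies pooling effect consistency -/

section Pooling

theorem lt_seniorTranche_iff {Ω : Type*} {K : ℝ} (hK : K < 1) {X : Ω → ℝ} {u : ℝ} (hu : 0 ≤ u) (ω : Ω) :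
    u < seniorTranche K X ω ↔ K + (1 - K) * u < X ω := by
  have hK1 : 0 < 1 - K := sub_pos.2 hK
  rw [seniorTranche, lt_div_iff₀ hK1, lt_max_iff,
    or_iff_left (not_lt.2 (mul_nonneg hu hK1.le)), lt_sub_iff_add_lt, mul_comm, add_comm]

theorem poolLoss_one {Ω : Type*} (L : ℕ → Ω → ℝ) : poolLoss L 1 = L 0 := by
  funext ω; simp [poolLoss]

variable {Ω : Type*} [MeasurableSpace Ω] {P : Measure Ω}

theorem seniorTranche_mem_unitRV {K : ℝ} (hK : K ∈ Set.Ico (0 : ℝ) 1) {X : Ω → ℝ}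
    (hX : X ∈ unitRV Ω) : seniorTranche K X ∈ unitRV Ω := by
  have hK1 : 0 < 1 - K := sub_pos.2 hK.2
  refine ⟨((hX.1.sub_const K).max measurable_const).div_const _, fun ω => ⟨?_, ?_⟩⟩
  · exact div_nonneg (le_max_right _ _) hK1.le
  · rw [seniorTranche, div_le_one hK1]
    exact max_le (by linarith [(hX.2 ω).2]) hK1.le

theorem poolingEffectConsistent_of_concaveOn [IsProbabilityMeasure P] {h : ℝ → ℝ}
    {ρ : (Ω → ℝ) → ℝ} (hρ : IsDistortionRiskMeasure P h ρ)
    (hconc : ConcaveOn ℝ (Set.Ico (0 : ℝ) 1) h) : PoolingEffectConsistent P ρ := by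
  rintro L hLu ⟨d, Z, hZ, hL⟩ ℓ ℓ' hℓ hℓ' K hK
  have hm := hZ.comap_le
  have hLm : ∀ i, Measurable (L i) := fun i => (hLu i).1
  have hK1 : 0 < 1 - K := sub_pos.2 hK.2
  have hT : ∀ n, seniorTranche K (poolLoss L n) ∈ unitRV Ω := fun n =>
    seniorTranche_mem_unitRV hK (poolLoss_mem_unitRV hLu n)
  rw [ge_iff_le, hρ.eq_setIntegral (hT ℓ), hρ.eq_setIntegral (hT ℓ')]
  have hsurv : ∀ n, 1 ≤ n → ∀ x, 0 ≤ x →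
      (P.real {ω | x < seniorTranche K (poolLoss L n) ω} = 1 ↔
        ∀ᵐ ω ∂P, K + (1 - K) * x < L 0 ω) := by
    intro n hn x hx
    rw [← hL.ae_lt_poolLoss_iff hm hLm hn]
    simp only [lt_seniorTranche_iff hK.2 hx]
    have hmeas : MeasurableSet {ω | K + (1 - K) * x < poolLoss L n ω} :=
      measurableSet_lt measurable_const (measurable_poolLoss hLm n)
    rw [Measure.real, ENNReal.toReal_eq_one_iff]
    exact (mem_ae_iff_prob_eq_one hmeas).symm
  refine hρ.distortion.setIntegral_comp_le hconc (antitone_survival _) (antitone_survival _)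
    (fun x => ⟨measureReal_nonneg, measureReal_le_one⟩)
    (fun x => ⟨measureReal_nonneg, measureReal_le_one⟩)
    (fun x hx => (hsurv ℓ hℓ x hx.1.le).trans (hsurv ℓ' (hℓ.trans hℓ') x hx.1.le).symm)
    fun t ht => ?_
  rw [setIntegral_survival_eq (hT _) ht, setIntegral_survival_eq (hT _) ht]
  have hconv : ConvexOn ℝ Set.univ fun x : ℝ => max ((1 - K)⁻¹ * max (x - K) 0) t := by
    have h1 : ConvexOn ℝ Set.univ fun x : ℝ => x - K :=
      ⟨convex_univ, fun x _ y _ a b _ _ hab => le_of_eq (by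
        simp only [smul_eq_mul]; linear_combination K * hab)⟩
    have h2 : ConvexOn ℝ Set.univ fun x : ℝ => max (x - K) 0 :=
      h1.sup (convexOn_const 0 convex_univ)
    exact (h2.smul (inv_nonneg.2 hK1.le)).sup (convexOn_const t convex_univ)
  have hcont : Continuous fun x : ℝ => max ((1 - K)⁻¹ * max (x - K) 0) t := by fun_prop
  have := hL.integral_comp_poolLoss_le hm hLu hcont hconv hℓ hℓ'
  simp only [seniorTranche, div_eq_inv_mul]
  linarith

theorem PoolingEffectConsistent.weak {ρ : (Ω → ℝ) → ℝ} (h : PoolingEffectConsistent P ρ) :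
    WeakPoolingEffectConsistent P ρ := by
  intro L hLu hL ℓ ℓ' hℓ hℓ'
  have h0 : ∀ n, seniorTranche 0 (poolLoss L n) = poolLoss L n := fun n => by
    funext ω
    simp [seniorTranche, ((poolLoss_mem_unitRV hLu n).2 ω).1]
  simpa only [h0] using h L hLu hL ℓ ℓ' hℓ hℓ' 0 ⟨le_rfl, zero_lt_one⟩

end Pooling

/-! ### Pooling inequalities imply concavity -/

section Converse

variable {Ω : Type*} [MeasurableSpace Ω] {P : Measure Ω}

theorem bernoulliMass_singleton_true (θ : ℝ) : bernoulliMass θ {true} = θ := by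
  simp [bernoulliMass]

/-- Chebyshev's inequality for Bernoulli variables that are independent on an event. -/
theorem measureReal_bernoulli_deviation_le [IsProbabilityMeasure P] {E : Set Ω}
    (hE : MeasurableSet E) {θ : ℝ} (hθ : θ ∈ Set.Icc (0 : ℝ) 1) {X : ℕ → Ω → Bool}
    (hX : ∀ i, Measurable (X i))
    (h : ∀ s : Finset ℕ, P.real (E ∩ ⋂ i ∈ s, X i ⁻¹' {true}) = P.real E * θ ^ s.card)
    {δ : ℝ} (hδ : 0 < δ) {ℓ : ℕ} (hℓ : 1 ≤ ℓ) :
    P.real {ω ∈ E | (ℓ * δ) ^ 2 ≤ (∑ i ∈ Finset.range ℓ, ((if X i ω then 1 else 0) - θ)) ^ 2} ≤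
      1 / (ℓ * δ ^ 2) := by
  have hℓ0 : (0 : ℝ) < ℓ := by exact_mod_cast hℓ
  let T : ℕ → Set Ω := fun i => X i ⁻¹' {true}
  have hT : ∀ i, MeasurableSet (T i) := fun i => hX i (measurableSet_singleton true)
  let D : ℕ → Ω → ℝ := fun i => E.indicator fun ω => (if X i ω then 1 else 0) - θ
  have hDm : ∀ i, Measurable (D i) := fun i => by
    refine Measurable.indicator ?_ hE
    exact (Measurable.of_discrete (f := fun b : Bool => ((if b then 1 else 0) - θ : ℝ))).comp (hX i)
  have hD1 : ∀ i ω, |D i ω| ≤ 1 := fun i ω => by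
    have h0 := hθ.1; have h1 := hθ.2
    by_cases hω : ω ∈ E <;> cases hXω : X i ω <;> simp [D, hω, hXω, abs_le] <;>
      constructor <;> linarith
  have hDDi : ∀ i j, Integrable (fun ω => D i ω * D j ω) P := fun i j =>
    Integrable.of_bound ((hDm i).mul (hDm j)).aestronglyMeasurable 1 (ae_of_all _ fun ω => by
      rw [norm_mul]
      exact mul_le_one₀ (hD1 i ω) (norm_nonneg _) (hD1 j ω))
  have hone : ∀ i, P.real (E ∩ T i) = P.real E * θ := fun i => by simpa using h {i}
  have hdiag : ∀ i, ∫ ω, D i ω * D i ω ∂P ≤ 1 := fun i => by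
    calc ∫ ω, D i ω * D i ω ∂P ≤ ∫ _, (1 : ℝ) ∂P :=
          integral_mono (hDDi i i) (integrable_const _) fun ω => by
            have := hD1 i ω
            dsimp only
            nlinarith [abs_nonneg (D i ω), abs_mul_abs_self (D i ω)]
      _ = 1 := by simp
  -- Cross terms vanish: `P.real E * (θ ^ 2 - θ * θ - θ * θ + θ ^ 2) = 0`.
  have hoff : ∀ i j, i ≠ j → ∫ ω, D i ω * D j ω ∂P = 0 := by
    intro i j hij
    have htwo : P.real (E ∩ (T i ∩ T j)) = P.real E * θ ^ 2 := by
      have := h {i, j}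
      rwa [Finset.set_biInter_insert, Finset.set_biInter_singleton, Finset.card_pair hij] at this
    have hpt : ∀ ω, D i ω * D j ω = (E ∩ (T i ∩ T j)).indicator (fun _ => (1 : ℝ)) ω -
        θ * (E ∩ T i).indicator (fun _ => (1 : ℝ)) ω -
        θ * (E ∩ T j).indicator (fun _ => (1 : ℝ)) ω +
        θ ^ 2 * E.indicator (fun _ => (1 : ℝ)) ω := by
      intro ω
      by_cases h1 : ω ∈ E <;> cases h2 : X i ω <;> cases h3 : X j ω <;>
        simp [D, T, h1, h2, h3] <;> ring
    have hind : ∀ {A : Set Ω}, MeasurableSet A →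
        Integrable (A.indicator fun _ => (1 : ℝ)) P := fun hA => (integrable_const _).indicator hA
    have hval : ∀ {A : Set Ω}, MeasurableSet A →
        ∫ ω, A.indicator (fun _ => (1 : ℝ)) ω ∂P = P.real A := fun hA => by
      rw [integral_indicator_const _ hA]; simp
    have m1 := hE.inter ((hT i).inter (hT j))
    have m2 := hE.inter (hT i)
    have m3 := hE.inter (hT j)
    have i1 : Integrable (fun ω => (E ∩ (T i ∩ T j)).indicator (fun _ => (1 : ℝ)) ω -
        θ * (E ∩ T i).indicator (fun _ => (1 : ℝ)) ω) P := (hind m1).sub ((hind m2).const_mul θ)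
    have i2 : Integrable (fun ω => (E ∩ (T i ∩ T j)).indicator (fun _ => (1 : ℝ)) ω -
        θ * (E ∩ T i).indicator (fun _ => (1 : ℝ)) ω -
        θ * (E ∩ T j).indicator (fun _ => (1 : ℝ)) ω) P := i1.sub ((hind m3).const_mul θ)
    simp only [hpt]
    rw [integral_add i2 ((hind hE).const_mul _), integral_sub i1 ((hind m3).const_mul θ),
      integral_sub (hind m1) ((hind m2).const_mul θ), integral_const_mul, integral_const_mul,
      integral_const_mul, hval m1, hval m2, hval m3, hval hE, htwo, hone, hone]
    ring
  have hsq : ∀ ω, (∑ i ∈ Finset.range ℓ, D i ω) ^ 2 =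
      ∑ i ∈ Finset.range ℓ, ∑ j ∈ Finset.range ℓ, D i ω * D j ω := fun ω => by
    rw [sq, Finset.sum_mul_sum]
  have hsqi : Integrable (fun ω => (∑ i ∈ Finset.range ℓ, D i ω) ^ 2) P := by
    simp only [hsq]
    exact integrable_finsetSum _ fun i _ => integrable_finsetSum _ fun j _ => hDDi i j
  have hvar : ∫ ω, (∑ i ∈ Finset.range ℓ, D i ω) ^ 2 ∂P ≤ ℓ := by
    simp only [hsq]
    rw [integral_finsetSum _ fun i _ => integrable_finsetSum _ fun j _ => hDDi i j]
    calc ∑ i ∈ Finset.range ℓ, ∫ ω, ∑ j ∈ Finset.range ℓ, D i ω * D j ω ∂P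
        ≤ ∑ _i ∈ Finset.range ℓ, (1 : ℝ) := by
          refine Finset.sum_le_sum fun i hi => ?_
          rw [integral_finsetSum _ fun j _ => hDDi i j,
            Finset.sum_eq_single_of_mem i hi fun j _ hj => hoff i j hj.symm]
          exact hdiag i
      _ = ℓ := by simp
  have hcheb := mul_meas_ge_le_integral_of_nonneg (μ := P)
    (ae_of_all _ fun ω => sq_nonneg (∑ i ∈ Finset.range ℓ, D i ω)) hsqi ((ℓ * δ) ^ 2)
  have hsub : P.real {ω ∈ E | (ℓ * δ) ^ 2 ≤
      (∑ i ∈ Finset.range ℓ, ((if X i ω then 1 else 0) - θ)) ^ 2} ≤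
      P.real {ω | (ℓ * δ) ^ 2 ≤ (∑ i ∈ Finset.range ℓ, D i ω) ^ 2} := by
    refine measureReal_mono ?_
    rintro ω ⟨hω, hω'⟩
    simpa [D, hω] using hω'
  refine hsub.trans ?_
  rw [le_div_iff₀ (by positivity)]
  have := hcheb.trans hvar
  have h2 : ℓ * (P.real {ω | (ℓ * δ) ^ 2 ≤ (∑ i ∈ Finset.range ℓ, D i ω) ^ 2} * (ℓ * δ ^ 2)) ≤
      ℓ * 1 := by
    calc _ = (ℓ * δ) ^ 2 * P.real {ω | (ℓ * δ) ^ 2 ≤ (∑ i ∈ Finset.range ℓ, D i ω) ^ 2} := by ring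
      _ ≤ _ := by rw [mul_one]; exact this
  exact le_of_mul_le_mul_left h2 hℓ0

/-- The total loss on an event of probability `p`, and iid Bernoulli losses with parameter `θ` on a
disjoint event of probability `r`: the pool loss is approximately `θ` on the latter. -/
theorem IsAtomless.exists_condIID_pool [IsProbabilityMeasure P] (hP : IsAtomless P) {p r θ : ℝ}
    (hp : 0 ≤ p) (hr : 0 ≤ r) (hpr : p + r ≤ 1) (hθ : θ ∈ Set.Icc (0 : ℝ) 1) :
    ∃ L : ℕ → Ω → ℝ, (∀ i, L i ∈ unitRV Ω) ∧ IsCondIID P L ∧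
      (∀ x ∈ Set.Ico (0 : ℝ) 1, P.real {ω | x < L 0 ω} = p + r * θ) ∧
      ∀ ℓ : ℕ, 1 ≤ ℓ → (∀ x < 1, p ≤ P.real {ω | x < poolLoss L ℓ ω}) ∧
        ∀ δ > 0, ∀ x < θ - δ, p + r - 1 / (ℓ * δ ^ 2) ≤ P.real {ω | x < poolLoss L ℓ ω} := by
  classical
  obtain ⟨A, -, hA, hAp⟩ := hP.exists_subset_eq MeasurableSet.univ hp (by
    rw [probReal_univ]; linarith)
  obtain ⟨B, hBA, hB, hBr⟩ := hP.exists_subset_eq hA.compl hr (by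
    rw [probReal_compl_eq_one_sub hA]; linarith)
  -- The common factor: `0` means total loss, `1` Bernoulli losses, `2` no loss.
  let N : Ω → ℕ := fun ω => if ω ∈ A then 0 else if ω ∈ B then 1 else 2
  have hN : Measurable N :=
    Measurable.ite hA measurable_const (Measurable.ite hB measurable_const measurable_const)
  have hNA : N ⁻¹' {0} = A := by
    ext ω
    by_cases h1 : ω ∈ A <;> by_cases h2 : ω ∈ B <;> simp [N, h1, h2]
  have hNB : N ⁻¹' {1} = B := by
    ext ω
    by_cases h1 : ω ∈ A
    · have : ω ∉ B := fun h => hBA h h1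
      simp [N, h1, this]
    · by_cases h2 : ω ∈ B <;> simp [N, h1, h2]
  obtain ⟨X, hX, hXP⟩ := hP.exists_bernoulli_sequence hθ hN
  let f : ℕ → Bool → ℝ := fun k b => if k = 0 then 1 else if k = 1 then (if b then 1 else 0) else 0
  let L : ℕ → Ω → ℝ := fun i ω => f (N ω) (X i ω)
  have hLA : ∀ i, ∀ ω ∈ A, L i ω = 1 := fun i ω hω => by
    simp [L, f, show N ω = 0 by simp [N, hω]]
  have hLB : ∀ i, ∀ ω ∈ B, L i ω = if X i ω then 1 else 0 := fun i ω hω => by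
    have hωA : ω ∉ A := hBA hω
    simp [L, f, show N ω = 1 by simp [N, hωA, hω]]
  have hLo : ∀ i, ∀ ω, ω ∉ A → ω ∉ B → L i ω = 0 := fun i ω h1 h2 => by
    simp [L, f, show N ω = 2 by simp [N, h1, h2]]
  have hdisj : Disjoint A B := Set.disjoint_left.2 fun ω h1 h2 => hBA h2 h1
  have hXB : ∀ s : Finset ℕ, P.real (B ∩ ⋂ i ∈ s, X i ⁻¹' {true}) = P.real B * θ ^ s.card := by
    intro s
    have := hXP s (fun _ => {true}) {1}
    rwa [hNB, Finset.prod_const, bernoulliMass_singleton_true] at this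
  refine ⟨L, fun i => ⟨?_, fun ω => ?_⟩, isCondIID_of_bernoulli hN hθ hX hXP f, ?_, ?_⟩
  · exact (Measurable.of_discrete (f := fun q : ℕ × Bool => f q.1 q.2)).comp (hN.prodMk (hX i))
  · simp only [L, f]
    split_ifs <;> simp
  · intro x hx
    have hset : {ω | x < L 0 ω} = A ∪ (B ∩ X 0 ⁻¹' {true}) := by
      ext ω
      simp only [Set.mem_ofPred_eq, Set.mem_union, Set.mem_inter_iff, Set.mem_preimage,
        Set.mem_singleton_iff]
      by_cases h1 : ω ∈ A
      · simp [hLA 0 ω h1, h1, hx.2]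
      · by_cases h2 : ω ∈ B
        · cases h3 : X 0 ω <;> simp [hLB 0 ω h2, h1, h2, h3, hx.1, hx.2]
        · simp [hLo 0 ω h1 h2, h1, h2, hx.1]
    have h0 : P.real (B ∩ X 0 ⁻¹' {true}) = r * θ := by simpa [hBr] using hXB {0}
    rw [hset, measureReal_union (hdisj.mono_right Set.inter_subset_left)
      (hB.inter (hX 0 (measurableSet_singleton true))), h0, hAp]
  · intro ℓ hℓ
    have hℓ0 : (0 : ℝ) < ℓ := by exact_mod_cast hℓ
    have hpoolA : ∀ ω ∈ A, poolLoss L ℓ ω = 1 := fun ω hω => by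
      simp [poolLoss, hLA _ ω hω, hℓ0.ne']
    refine ⟨fun x hx => ?_, fun δ hδ x hx => ?_⟩
    · rw [← hAp]
      exact measureReal_mono fun ω hω => by
        change x < poolLoss L ℓ ω
        rwa [hpoolA ω hω]
    · set bad : Set Ω := {ω ∈ B | (ℓ * δ) ^ 2 ≤
        (∑ i ∈ Finset.range ℓ, ((if X i ω then 1 else 0) - θ)) ^ 2} with hbad
      have hbadP := measureReal_bernoulli_deviation_le hB hθ hX hXB hδ hℓ
      have hsub : (A ∪ B) \ bad ⊆ {ω | x < poolLoss L ℓ ω} := by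
        rintro ω ⟨hω, hωbad⟩
        change x < poolLoss L ℓ ω
        by_cases h1 : ω ∈ A
        · rw [hpoolA ω h1]; linarith [hθ.2]
        have h2 : ω ∈ B := hω.resolve_left h1
        have h3 : (∑ i ∈ Finset.range ℓ, ((if X i ω then 1 else 0) - θ)) ^ 2 < (ℓ * δ) ^ 2 :=
          not_le.1 fun h => hωbad ⟨h2, h⟩
        have h4 := (abs_lt.1 (abs_lt_of_sq_lt_sq h3 (by positivity))).1
        rw [Finset.sum_sub_distrib, Finset.sum_const, Finset.card_range, nsmul_eq_mul] at h4
        rw [poolLoss, lt_div_iff₀ hℓ0, Finset.sum_congr rfl fun i _ => hLB i ω h2]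
        nlinarith
      have h1 := measureReal_mono (μ := P) hsub
      have h2 := le_measureReal_sdiff (μ := P) (s₁ := A ∪ B) (s₂ := bad)
      rw [measureReal_union hdisj hB, hAp, hBr] at h2
      linarith

/-- The gap `q < p + r` absorbs the probability lost in Chebyshev's inequality, so no continuity of
`h` is used. -/
theorem le_comp_of_pool_le [IsProbabilityMeasure P] (hP : IsAtomless P) {h : ℝ → ℝ}
    {ρ : (Ω → ℝ) → ℝ} (hρ : IsDistortionRiskMeasure P h ρ)
    (hpool : ∀ L : ℕ → Ω → ℝ, (∀ i, L i ∈ unitRV Ω) → IsCondIID P L →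
        ∀ ℓ : ℕ, 1 ≤ ℓ → ρ (L 0) ≥ ρ (poolLoss L ℓ)) {p r θ q : ℝ}
    (hp : 0 ≤ p) (hr : 0 ≤ r) (hpr : p + r ≤ 1) (hθ : θ ∈ Set.Ioc (0 : ℝ) 1)
    (hq0 : 0 ≤ q) (hq : q < p + r) :
    θ * h q + (1 - θ) * h p ≤ h (p + r * θ) := by
  obtain ⟨L, hLu, hL, hL0, hLℓ⟩ := hP.exists_condIID_pool hp hr hpr ⟨hθ.1.le, hθ.2⟩
  have hmono := hρ.distortion.monotoneOn
  have hρ0 : ρ (L 0) = h (p + r * θ) := by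
    rw [hρ.eq_setIntegral (hLu 0), integral_Ioc_eq_integral_Ioo,
      setIntegral_congr_fun measurableSet_Ioo (g := fun _ => h (p + r * θ)) fun x hx => ?_]
    · simp
    · simp only [hL0 x ⟨hx.1.le, hx.2⟩]
  have hδ : ∀ δ ∈ Set.Ioo 0 θ, (θ - δ) * h q + (1 - (θ - δ)) * h p ≤ h (p + r * θ) := by
    intro δ hδ
    -- For this `n` the Chebyshev error is at most `p + r - q`, so the pool's survival function is
    -- at least `q` below `θ - δ`, and at least `p` up to `1`.
    obtain ⟨n, hn⟩ := exists_nat_gt (1 / ((p + r - q) * δ ^ 2))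
    have hgap : 0 < p + r - q := sub_pos.2 hq
    have hδ2 : 0 < δ ^ 2 := pow_pos hδ.1 2
    have hn0 : (0 : ℝ) < n := lt_trans (by positivity) hn
    have hn1 : 1 ≤ n := by exact_mod_cast hn0
    have hsmall : 1 / (n * δ ^ 2) ≤ p + r - q := by
      rw [div_lt_iff₀ (by positivity)] at hn
      rw [div_le_iff₀ (by positivity)]
      nlinarith
    obtain ⟨hLp, hLδ⟩ := hLℓ n hn1
    have hle := hpool L hLu hL n hn1
    rw [ge_iff_le, hρ0, hρ.eq_setIntegral (poolLoss_mem_unitRV hLu n)] at hle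
    refine le_trans ?_ hle
    set S : ℝ → ℝ := fun x => P.real {ω | x < poolLoss L n ω} with hS
    have hS01 : ∀ x, S x ∈ Set.Icc (0 : ℝ) 1 := fun x => ⟨measureReal_nonneg, measureReal_le_one⟩
    have hint : IntegrableOn (fun x => h (S x)) (Set.Ioc 0 1) :=
      integrableOn_comp_antitone hmono (antitone_survival _) hS01
    have ht0 : 0 ≤ θ - δ := by linarith [hδ.2]
    have ht1 : θ - δ ≤ 1 := by linarith [hδ.1, hθ.2]
    have hi1 := hint.mono_set (Set.Ioc_subset_Ioc_right ht1)
    have hi2 := hint.mono_set (Set.Ioc_subset_Ioc_left ht0)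
    change _ ≤ ∫ x in Set.Ioc 0 1, h (S x)
    rw [← Set.Ioc_union_Ioc_eq_Ioc ht0 ht1,
      setIntegral_union (Set.Ioc_disjoint_Ioc_of_le le_rfl) measurableSet_Ioc hi1 hi2]
    have h1 : (θ - δ) * h q ≤ ∫ x in Set.Ioc 0 (θ - δ), h (S x) := by
      rw [integral_Ioc_eq_integral_Ioo]
      calc (θ - δ) * h q = ∫ _ in Set.Ioo 0 (θ - δ), h q := by simp [ht0]
        _ ≤ _ := setIntegral_mono_on (integrableOn_const (by simp)) (hi1.mono_set
            Set.Ioo_subset_Ioc_self) measurableSet_Ioo fun x hx =>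
              hmono ⟨hq0, by linarith⟩ (hS01 x) (by linarith [hLδ δ hδ.1 x hx.2])
    have h2 : (1 - (θ - δ)) * h p ≤ ∫ x in Set.Ioc (θ - δ) 1, h (S x) := by
      rw [integral_Ioc_eq_integral_Ioo]
      calc (1 - (θ - δ)) * h p = ∫ _ in Set.Ioo (θ - δ) 1, h p := by simp [ht1]
        _ ≤ _ := setIntegral_mono_on (integrableOn_const (by simp)) (hi2.mono_set
            Set.Ioo_subset_Ioc_self) measurableSet_Ioo fun x hx =>
              hmono ⟨hp, by linarith⟩ (hS01 x) (hLp x hx.2)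
    exact add_le_add h1 h2
  have hlim : Filter.Tendsto (fun δ : ℝ => (θ - δ) * h q + (1 - (θ - δ)) * h p)
      (nhdsWithin 0 (Set.Ioi 0)) (nhds (θ * h q + (1 - θ) * h p)) := by
    have : Continuous fun δ : ℝ => (θ - δ) * h q + (1 - (θ - δ)) * h p := by fun_prop
    simpa using (this.tendsto 0).mono_left nhdsWithin_le_nhds
  exact le_of_tendsto hlim (Filter.mem_of_superset (Ioo_mem_nhdsGT hθ.1) hδ)

theorem concaveOn_of_pool_le [IsProbabilityMeasure P] (hP : IsAtomless P) {h : ℝ → ℝ}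
    {ρ : (Ω → ℝ) → ℝ} (hρ : IsDistortionRiskMeasure P h ρ)
    (hpool : ∀ L : ℕ → Ω → ℝ, (∀ i, L i ∈ unitRV Ω) → IsCondIID P L →
        ∀ ℓ : ℕ, 1 ≤ ℓ → ρ (L 0) ≥ ρ (poolLoss L ℓ)) :
    ConcaveOn ℝ (Set.Ico (0 : ℝ) 1) h := by
  refine LinearOrder.concaveOn_of_lt (convex_Ico 0 1) fun a ha b hb hab s t hs ht hst => ?_
  have hs' : s = 1 - t := by linarith
  have hba : 0 < b - a := sub_pos.2 hab
  -- Chosen so that `a + (c - a) * θ c` is the given convex combination of `a` and `b`. Taking `p =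
  -- a`, `p + r = c` and `q = b` needs `c > b`; then `c` decreases to `b`, where `θ b = t`.
  let θ : ℝ → ℝ := fun c => t * (b - a) / (c - a)
  have hineq : ∀ c ∈ Set.Ioo b 1, θ c * h b + (1 - θ c) * h a ≤ h (s • a + t • b) := by
    intro c hc
    have hca : 0 < c - a := by linarith [hc.1]
    have hθ : θ c ∈ Set.Ioc (0 : ℝ) 1 := by
      refine ⟨by positivity, ?_⟩
      rw [div_le_one hca]
      nlinarith [hc.1]
    have := le_comp_of_pool_le hP hρ hpool ha.1 hca.le (by linarith [hc.2]) hθ hb.1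
      (by linarith [hc.1])
    have heq : a + (c - a) * θ c = s • a + t • b := by
      rw [mul_div_cancel₀ _ hca.ne', hs', smul_eq_mul, smul_eq_mul]; ring
    rwa [heq] at this
  have hθb : θ b = t := mul_div_cancel_right₀ _ hba.ne'
  have hcont : ContinuousAt (fun c => θ c * h b + (1 - θ c) * h a) b := by
    have : ContinuousAt θ b := continuousAt_const.div (by fun_prop) hba.ne'
    fun_prop
  have hlim := hcont.tendsto.mono_left (nhdsWithin_le_nhds (s := Set.Ioi b))
  have := le_of_tendsto hlim (Filter.mem_of_superset (Ioo_mem_nhdsGT hb.2) hineq)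
  rw [hθb] at this
  calc s • h a + t • h b = t * h b + (1 - t) * h a := by
        rw [hs', smul_eq_mul, smul_eq_mul]; ring
    _ ≤ h (s • a + t • b) := this

end Converse

theorem theorem5 {Ω : Type*} [MeasurableSpace Ω] (P : Measure Ω) [IsProbabilityMeasure P]
    (hP : IsAtomless P) (h : ℝ → ℝ) (ρ : (Ω → ℝ) → ℝ) (hρ : IsDistortionRiskMeasure P h ρ) :
    List.TFAE [
      ConcaveOn ℝ (Set.Ico (0 : ℝ) 1) h,
      PoolingEffectConsistent P ρ,
      WeakPoolingEffectConsistent P ρ,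
      ∀ L : ℕ → Ω → ℝ, (∀ i, L i ∈ unitRV Ω) → IsCondIID P L →
        ∀ ℓ : ℕ, 1 ≤ ℓ → ρ (L 0) ≥ ρ (poolLoss L ℓ)] := by
  tfae_have 1 → 2 := poolingEffectConsistent_of_concaveOn hρ
  tfae_have 2 → 3 := PoolingEffectConsistent.weak
  tfae_have 3 → 4 := fun hw L hLu hL ℓ hℓ => by
    simpa only [poolLoss_one] using hw L hLu hL 1 ℓ le_rfl hℓ
  tfae_have 4 → 1 := concaveOn_of_pool_le hP hρ
  tfae_finish
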